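/- Let $H$ be a complex Hilbert space, $B(H)$ the algebra of bounded linear operators on $H$ and $B(H)_*$ its predual, i.e. the space of functionals $x\mapsto\sum_n\langle x\xi_n,\eta_n\rangle$ with $\sum_n\|\xi_n\|^2<\infty$ and $\sum_n\|\eta_n\|^2<\infty$; the $\sigma$-weak topology on $B(H)$ is the coarsest one making all these functionals continuous. A multiplicative unitary on $H$ is a unitary $W\in B(H\otimes H)$ (Hilbert space tensor product) with $W_{12}W_{13}W_{23}=W_{23}W_{12}$ on $H\otimes H\otimes H$, where $W_{12}=W\otimes 1$, $W_{23}=1\otimes W$, $W_{13}=(1\otimes\Sigma)W_{12}(1\otimes\Sigma)$ and $\Sigma$ is the flip $\xi\otimes\eta\mapsto\eta\otimes\xi$. Put $$S=\{(\iota\otimes\omega)(W)\mid\omega\in B(H)_*\},\qquad \widehat S=\{(\omega\otimes\iota)(W)\mid\omega\in B(H)_*\},$$ where $\iota$ is the identity map, so that $(\iota\otimes\omega)(a\otimes b)=\omega(b)a$ and $(\omega\otimes\iota)(a\otimes b)=\omega(a)b$, and let $M$ and $\widehat M$ be the von Neumann algebras generated by $S$ and by $\widehat S$, respectively. A multiplicative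 unitary $W$ is called trim if the linear span of $\{s\,\hat s^{*}\mid s\in S,\ \hat s\in\widehat S\}$ is $\sigma$-weakly dense in $B(H)$. A quantum group frame on $H$ is a triple $(W,J,\widehat J)$ where $W$ is a trim multiplicative unitary on $H$, and $J$, $\widehat J$ are anti-linear operators on $H$ such that $J=J^*$, $J^2=1$, $\widehat J=\widehat J^{*}$, $\widehat J^{2}=1$ (so they are anti-unitary involutions), $W^*=(\widehat J\otimes J)W(\widehat J\otimes J)$, $JMJ\subseteq M'$ and $\widehat J\widehat M\widehat J\subseteq\widehat M'$, where $M'$ and $\widehat M'$ are the commutants in $B(H)$. Theorem. Let $(W,J,\widehat J)$ be a quantum group frame on $H$. Then the $\sigma$-weak closure of $S$ is a $*$-algebra, and it coincides with the von Neumann algebra $M$. Similarly, the $\sigma$-weak closure of $\widehat S$ is a $*$-algebra and coincides with the von Neumann algebra $\widehat M$. -/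

import Mathlib

open scoped TensorProduct InnerProductSpace ComplexConjugate

noncomputable section

namespace QGF

universe u

/-! ### Hilbert space tensor products -/

section HilbertTensor

/-- The Hilbert space tensor product: the completion of the algebraic tensor product for the inner
product `⟪a ⊗ b, c ⊗ d⟫ = ⟪a, c⟫ * ⟪b, d⟫`. -/
def HTensor (E F : Type*) [NormedAddCommGroup E] [InnerProductSpace ℂ E]
    [NormedAddCommGroup F] [InnerProductSpace ℂ F] : Type _ :=
  UniformSpace.Completion (E ⊗[ℂ] F)

variable {E F G E' F' : Type*}
  [NormedAddCommGroup E] [InnerProductSpace ℂ E]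
  [NormedAddCommGroup F] [InnerProductSpace ℂ F]
  [NormedAddCommGroup G] [InnerProductSpace ℂ G]
  [NormedAddCommGroup E'] [InnerProductSpace ℂ E']
  [NormedAddCommGroup F'] [InnerProductSpace ℂ F']

instance : NormedAddCommGroup (HTensor E F) :=
  inferInstanceAs (NormedAddCommGroup (UniformSpace.Completion (E ⊗[ℂ] F)))

instance : InnerProductSpace ℂ (HTensor E F) :=
  inferInstanceAs (InnerProductSpace ℂ (UniformSpace.Completion (E ⊗[ℂ] F)))

instance : CompleteSpace (HTensor E F) :=
  inferInstanceAs (CompleteSpace (UniformSpace.Completion (E ⊗[ℂ] F)))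

/-- The dense isometric embedding of the algebraic tensor product. -/
def emb : E ⊗[ℂ] F →ₗᵢ[ℂ] HTensor E F :=
  (UniformSpace.Completion.toComplₗᵢ : E ⊗[ℂ] F →ₗᵢ[ℂ] UniformSpace.Completion (E ⊗[ℂ] F))

theorem denseRange_emb : DenseRange (emb : E ⊗[ℂ] F →ₗᵢ[ℂ] HTensor E F) :=
  UniformSpace.Completion.denseRange_coe (α := E ⊗[ℂ] F)

/-- The elementary tensor `x ⊗ y` in the Hilbert space tensor product. -/
def tmulH (x : E) (y : F) : HTensor E F := emb (x ⊗ₜ[ℂ] y)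

@[simp] theorem inner_tmulH (x x' : E) (y y' : F) :
    ⟪tmulH x y, tmulH x' y'⟫_ℂ = ⟪x, x'⟫_ℂ * ⟪y, y'⟫_ℂ := by
  rw [tmulH, tmulH, LinearIsometry.inner_map_map, TensorProduct.inner_tmul]

/-- `x ↦ (y ↦ x ⊗ y)`. -/
def leftLeg : E →L[ℂ] F →L[ℂ] HTensor E F :=
  (ContinuousLinearMap.compL ℂ F (E ⊗[ℂ] F) (HTensor E F) emb.toContinuousLinearMap).comp
    (TensorProduct.mkL ℂ E F)

/-- `y ↦ (x ↦ x ⊗ y)`. -/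
def rightLeg : F →L[ℂ] E →L[ℂ] HTensor E F := (leftLeg : E →L[ℂ] F →L[ℂ] HTensor E F).flip

@[simp] theorem leftLeg_apply (x : E) (y : F) : leftLeg x y = tmulH x y := rfl

@[simp] theorem rightLeg_apply (x : E) (y : F) : rightLeg y x = tmulH x y := rfl

/-- The continuous extension to the Hilbert space tensor products of a bounded linear or
anti-linear operator between algebraic tensor products. -/
def extendH {σ : ℂ →+* ℂ} (f : E ⊗[ℂ] F →SL[σ] E' ⊗[ℂ] F') : HTensor E F →SL[σ] HTensor E' F' :=
  (f.completion : UniformSpace.Completion (E ⊗[ℂ] F) →SL[σ] UniformSpace.Completion (E' ⊗[ℂ] F'))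

@[simp] theorem extendH_emb {σ : ℂ →+* ℂ} (f : E ⊗[ℂ] F →SL[σ] E' ⊗[ℂ] F') (t : E ⊗[ℂ] F) :
    extendH f (emb t) = emb (f t) :=
  f.completion_apply_coe t

/-- The tensor product `a ⊗ b` of two bounded operators. -/
def mapH (a : E →L[ℂ] E') (b : F →L[ℂ] F') : HTensor E F →L[ℂ] HTensor E' F' :=
  extendH (TensorProduct.mapL a b)

@[simp] theorem mapH_tmulH (a : E →L[ℂ] E') (b : F →L[ℂ] F') (x : E) (y : F) :
    mapH a b (tmulH x y) = tmulH (a x) (b y) := by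
  simp [mapH, tmulH]

/-- The flip `Σ (x ⊗ y) = y ⊗ x`. -/
def flipH : HTensor E F →L[ℂ] HTensor F E :=
  extendH ((TensorProduct.commIsometry ℂ E F).toContinuousLinearEquiv :
    E ⊗[ℂ] F →L[ℂ] F ⊗[ℂ] E)

@[simp] theorem flipH_tmulH (x : E) (y : F) : flipH (tmulH x y) = tmulH y x := by
  simp [flipH, tmulH]

/-- The embedding of the algebraic tensor product `(E ⊗ F) ⊗ G` in the Hilbert space one. -/
def triLeft : (E ⊗[ℂ] F) ⊗[ℂ] G →ₗᵢ[ℂ] HTensor (HTensor E F) G :=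
  emb.comp (emb.rTensor G)

/-- The embedding of the algebraic tensor product `E ⊗ (F ⊗ G)` in the Hilbert space one. -/
def triRight : E ⊗[ℂ] (F ⊗[ℂ] G) →ₗᵢ[ℂ] HTensor E (HTensor F G) :=
  emb.comp (emb.lTensor E)

/-- A closed subspace containing all elementary tensors is everything. -/
theorem mem_of_tmulH_mem (p : Submodule ℂ (HTensor E F))
    (hp : IsClosed (p : Set (HTensor E F))) (h : ∀ x y, tmulH x y ∈ p) (t : HTensor E F) :
    t ∈ p := by
  induction t using denseRange_emb.induction_on with
  | hp => exact hp
  | ih a =>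
    induction a with
    | zero => simp
    | add a b ha hb => rw [map_add]; exact p.add_mem ha hb
    | tmul x y => exact h x y

theorem denseRange_triLeft :
    DenseRange (triLeft : (E ⊗[ℂ] F) ⊗[ℂ] G →ₗᵢ[ℂ] HTensor (HTensor E F) G).toLinearMap := by
  intro t
  let p := (LinearMap.range
    (triLeft : (E ⊗[ℂ] F) ⊗[ℂ] G →ₗᵢ[ℂ] HTensor (HTensor E F) G).toLinearMap).topologicalClosure
  have hp : IsClosed (p : Set (HTensor (HTensor E F) G)) := Submodule.isClosed_topologicalClosure _
  refine mem_of_tmulH_mem p hp (fun s z => ?_) t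
  induction s using denseRange_emb.induction_on with
  | hp => exact hp.preimage (rightLeg (E := HTensor E F) z).continuous
  | ih a => exact subset_closure ⟨a ⊗ₜ z, rfl⟩

theorem denseRange_triRight :
    DenseRange (triRight : E ⊗[ℂ] (F ⊗[ℂ] G) →ₗᵢ[ℂ] HTensor E (HTensor F G)).toLinearMap := by
  intro t
  let p := (LinearMap.range
    (triRight : E ⊗[ℂ] (F ⊗[ℂ] G) →ₗᵢ[ℂ] HTensor E (HTensor F G)).toLinearMap).topologicalClosure
  have hp : IsClosed (p : Set (HTensor E (HTensor F G))) := Submodule.isClosed_topologicalClosure _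
  refine mem_of_tmulH_mem p hp (fun x s => ?_) t
  induction s using denseRange_emb.induction_on with
  | hp => exact hp.preimage (leftLeg (F := HTensor F G) x).continuous
  | ih a => exact subset_closure ⟨x ⊗ₜ a, rfl⟩

variable (E F G) in
/-- The canonical identification `(E ⊗ F) ⊗ G ≃ E ⊗ (F ⊗ G)`. -/
def assocH : HTensor (HTensor E F) G ≃ₗᵢ[ℂ] HTensor E (HTensor F G) :=
  (TensorProduct.assoc ℂ E F G).extendOfIsometry triLeft.toLinearMap triRight.toLinearMap
    denseRange_triLeft denseRange_triRight fun x => by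
      change ‖triRight _‖ = ‖triLeft x‖
      rw [LinearIsometry.norm_map, LinearIsometry.norm_map, TensorProduct.norm_assoc]

@[simp] theorem assocH_tmulH (x : E) (y : F) (z : G) :
    assocH E F G (tmulH (tmulH x y) z) = tmulH x (tmulH y z) :=
  LinearEquiv.extendOfIsometry_eq (TensorProduct.assoc ℂ E F G) triLeft.toLinearMap
    triRight.toLinearMap denseRange_triLeft denseRange_triRight _ ((x ⊗ₜ y) ⊗ₜ z)

@[simp] theorem assocH_symm_tmulH (x : E) (y : F) (z : G) :
    (assocH E F G).symm (tmulH x (tmulH y z)) = tmulH (tmulH x y) z := by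
  rw [← assocH_tmulH, LinearIsometryEquiv.symm_apply_apply]

end HilbertTensor

variable {H : Type u} [NormedAddCommGroup H] [InnerProductSpace ℂ H]

/-! ### Multiplicative unitaries -/

/-- `W₁₂ = W ⊗ 1` on `H ⊗ (H ⊗ H)`. -/
def leg12 (W : HTensor H H →L[ℂ] HTensor H H) :
    HTensor H (HTensor H H) →L[ℂ] HTensor H (HTensor H H) :=
  ((assocH H H H : HTensor (HTensor H H) H →L[ℂ] HTensor H (HTensor H H)).comp
    (mapH W (ContinuousLinearMap.id ℂ H))).comp
    ((assocH H H H).symm : HTensor H (HTensor H H) →L[ℂ] HTensor (HTensor H H) H)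

/-- `W₂₃ = 1 ⊗ W` on `H ⊗ (H ⊗ H)`. -/
def leg23 (W : HTensor H H →L[ℂ] HTensor H H) :
    HTensor H (HTensor H H) →L[ℂ] HTensor H (HTensor H H) :=
  mapH (ContinuousLinearMap.id ℂ H) W

/-- `W₁₃ = (1 ⊗ Σ) W₁₂ (1 ⊗ Σ)` on `H ⊗ (H ⊗ H)`. -/
def leg13 (W : HTensor H H →L[ℂ] HTensor H H) :
    HTensor H (HTensor H H) →L[ℂ] HTensor H (HTensor H H) :=
  leg23 flipH * leg12 W * leg23 flipH

/-- A multiplicative unitary: a unitary with `W₁₂ W₁₃ W₂₃ = W₂₃ W₁₂`. -/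
structure IsMultiplicativeUnitary (W : HTensor H H →L[ℂ] HTensor H H) : Prop where
  mem_unitary : W ∈ unitary (HTensor H H →L[ℂ] HTensor H H)
  pentagon : leg12 W * leg13 W * leg23 W = leg23 W * leg12 W

/-! ### The predual, the `σ`-weak topology and generated von Neumann algebras -/

variable (H) in
/-- The predual `B(H)_*`: the functionals of the form `x ↦ ∑ₙ ⟨x ξₙ, ηₙ⟩` with
`∑ₙ ‖ξₙ‖² < ∞` and `∑ₙ ‖ηₙ‖² < ∞`. -/
def predual : Set (StrongDual ℂ (H →L[ℂ] H)) :=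
  {ω | ∃ ξ η : ℕ → H, Summable (fun n => ‖ξ n‖ ^ 2) ∧ Summable (fun n => ‖η n‖ ^ 2) ∧
    ∀ x : H →L[ℂ] H, HasSum (fun n => ⟪η n, x (ξ n)⟫_ℂ) (ω x)}

variable (H) in
/-- The `σ`-weak topology on `B(H)`: the coarsest topology making every element of the predual
continuous. -/
@[reducible] def sigmaWeakTopology : TopologicalSpace (H →L[ℂ] H) :=
  TopologicalSpace.induced (fun x (ω : predual H) => (ω : StrongDual ℂ (H →L[ℂ] H)) x)
    Pi.topologicalSpace

/-- The `σ`-weak closure of a set of operators. -/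
def sigmaWeakClosure (s : Set (H →L[ℂ] H)) : Set (H →L[ℂ] H) :=
  @closure _ (sigmaWeakTopology H) s

/-! ### Anti-unitary involutions -/

variable (H) in
/-- An anti-linear operator `J` on `H` with `J = J*` (that is, `⟨J x, y⟩ = ⟨J y, x⟩`) and
`J² = 1`. Such an operator is automatically anti-unitary. -/
structure AntiunitaryInvolution where
  toFun : H →ₗ⋆[ℂ] H
  selfAdjoint : ∀ x y, ⟪toFun x, y⟫_ℂ = ⟪toFun y, x⟫_ℂ
  involutive : ∀ x, toFun (toFun x) = x

namespace AntiunitaryInvolution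

theorem inner_map_map (J : AntiunitaryInvolution H) (x y : H) :
    ⟪J.toFun x, J.toFun y⟫_ℂ = ⟪y, x⟫_ℂ := by
  rw [J.selfAdjoint, J.involutive]

/-- `J` as a bounded anti-linear operator. -/
def toCLM (J : AntiunitaryInvolution H) : H →L⋆[ℂ] H :=
  J.toFun.mkContinuous 1 fun x => by
    rw [one_mul, @norm_eq_sqrt_re_inner ℂ, @norm_eq_sqrt_re_inner ℂ _ _ _ _ x, J.inner_map_map]

/-- `x ↦ J x J` on bounded linear operators. -/
def conjugate (J : AntiunitaryInvolution H) (x : H →L[ℂ] H) : H →L[ℂ] H :=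
  J.toCLM.comp (x.comp J.toCLM)

theorem inner_map_tensor (J K : AntiunitaryInvolution H) (s t : H ⊗[ℂ] H) :
    ⟪TensorProduct.map J.toFun K.toFun s, TensorProduct.map J.toFun K.toFun t⟫_ℂ = ⟪t, s⟫_ℂ := by
  induction s with
  | zero => simp
  | add s s' hs hs' => simp [inner_add_left, inner_add_right, hs, hs']
  | tmul x y =>
    induction t with
    | zero => simp
    | add t t' ht ht' => rw [map_add, inner_add_left, inner_add_right, ht, ht']
    | tmul x' y' => simp [inner_map_map]

/-- The anti-linear operator `J ⊗ K` on `H ⊗ H`, with `(J ⊗ K)(x ⊗ y) = J x ⊗ K y`. -/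
def tensor (J K : AntiunitaryInvolution H) : HTensor H H →L⋆[ℂ] HTensor H H :=
  extendH ((TensorProduct.map J.toFun K.toFun).mkContinuous 1 fun t => by
    rw [one_mul, @norm_eq_sqrt_re_inner ℂ, @norm_eq_sqrt_re_inner ℂ _ _ _ _ t, inner_map_tensor])

@[simp] theorem tensor_tmulH (J K : AntiunitaryInvolution H) (x y : H) :
    J.tensor K (tmulH x y) = tmulH (J.toFun x) (K.toFun y) := by
  simp [tensor, tmulH]

end AntiunitaryInvolution

variable [CompleteSpace H]

/-- The von Neumann algebra generated by a set of operators: the bicommutant of its union with its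
adjoint. -/
def generatedVN (s : Set (H →L[ℂ] H)) : VonNeumannAlgebra H where
  toStarSubalgebra :=
    StarSubalgebra.centralizer ℂ (StarSubalgebra.centralizer ℂ s : Set (H →L[ℂ] H))
  centralizer_centralizer' := by
    change Set.centralizer (Set.centralizer (Set.centralizer _)) = Set.centralizer _
    rw [Set.centralizer_centralizer_centralizer]

/-- `generatedVN s` is the smallest von Neumann algebra containing `s`. -/
theorem isLeast_generatedVN (s : Set (H →L[ℂ] H)) :
    IsLeast {N : VonNeumannAlgebra H | s ⊆ N} (generatedVN s) := by
  have key : ((generatedVN s : VonNeumannAlgebra H) : Set (H →L[ℂ] H)) =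
      Set.centralizer (Set.centralizer (s ∪ star s)) := by
    change ((StarSubalgebra.centralizer ℂ
      (StarSubalgebra.centralizer ℂ s : Set (H →L[ℂ] H)) : StarSubalgebra ℂ (H →L[ℂ] H)) :
        Set (H →L[ℂ] H)) = _
    exact StarSubalgebra.coe_centralizer_centralizer ℂ s
  constructor
  · change s ⊆ ((generatedVN s : VonNeumannAlgebra H) : Set (H →L[ℂ] H))
    rw [key]
    exact Set.subset_union_left.trans Set.subset_centralizer_centralizer
  · intro N hN
    change ((generatedVN s : VonNeumannAlgebra H) : Set (H →L[ℂ] H)) ⊆ N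
    rw [key, ← N.centralizer_centralizer]
    refine Set.centralizer_subset (Set.centralizer_subset (Set.union_subset hN ?_))
    intro x hx
    have := star_mem (hN hx)
    simpa using this

/-! ### Slice maps -/

/-- For an operator `T` on `K` and a family of operators `L x : H → K` depending linearly on `x`,
the operator `A` on `H` with `⟨A x, y⟩ = ω ((L y)* T (L x))`. -/
def sliceAlong {K : Type*} [NormedAddCommGroup K] [InnerProductSpace ℂ K] [CompleteSpace K]
    (L : H →L[ℂ] H →L[ℂ] K) (T : K →L[ℂ] K) (ω : StrongDual ℂ (H →L[ℂ] H)) : H →L[ℂ] H :=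
  ContinuousLinearMap.adjoint (InnerProductSpace.continuousLinearMapOfBilin
    (LinearMap.mkContinuous₂
      (LinearMap.mk₂'ₛₗ (starRingEnd ℂ) (RingHom.id ℂ)
        (fun y x => ω ((ContinuousLinearMap.adjoint (L y)).comp (T.comp (L x))))
        (fun y y' x => by simp [ContinuousLinearMap.add_comp])
        (fun c y x => by
          simp only [map_smulₛₗ, ContinuousLinearMap.smul_comp, smul_eq_mul, RingHom.id_apply])
        (fun y x x' => by simp [ContinuousLinearMap.comp_add])
        (fun c y x => by simp))
      (‖ω‖ * ‖L‖ * ‖T‖ * ‖L‖) (fun y x => by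
        have h1 : ‖(ContinuousLinearMap.adjoint (L y)).comp (T.comp (L x))‖ ≤
            (‖L‖ * ‖y‖) * (‖T‖ * (‖L‖ * ‖x‖)) := by
          refine (ContinuousLinearMap.opNorm_comp_le _ _).trans ?_
          refine mul_le_mul ?_ ?_ (norm_nonneg _) (by positivity)
          · rw [LinearIsometryEquiv.norm_map]; exact L.le_opNorm y
          · refine (ContinuousLinearMap.opNorm_comp_le _ _).trans ?_
            exact mul_le_mul_of_nonneg_left (L.le_opNorm x) (norm_nonneg _)
        calc ‖ω ((ContinuousLinearMap.adjoint (L y)).comp (T.comp (L x)))‖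
            ≤ ‖ω‖ * ((‖L‖ * ‖y‖) * (‖T‖ * (‖L‖ * ‖x‖))) :=
              (ω.le_opNorm _).trans (mul_le_mul_of_nonneg_left h1 (norm_nonneg _))
          _ = ‖ω‖ * ‖L‖ * ‖T‖ * ‖L‖ * ‖y‖ * ‖x‖ := by ring)))

theorem inner_sliceAlong {K : Type*} [NormedAddCommGroup K] [InnerProductSpace ℂ K]
    [CompleteSpace K] (L : H →L[ℂ] H →L[ℂ] K) (T : K →L[ℂ] K) (ω : StrongDual ℂ (H →L[ℂ] H))
    (x y : H) :
    ⟪y, sliceAlong L T ω x⟫_ℂ = ω ((ContinuousLinearMap.adjoint (L y)).comp (T.comp (L x))) := by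
  rw [sliceAlong, ContinuousLinearMap.adjoint_inner_right,
    InnerProductSpace.continuousLinearMapOfBilin_apply]
  rfl

/-- `(ι ⊗ ω)(T)`. -/
def sliceRight (ω : StrongDual ℂ (H →L[ℂ] H)) (T : HTensor H H →L[ℂ] HTensor H H) : H →L[ℂ] H :=
  sliceAlong leftLeg T ω

/-- `(ω ⊗ ι)(T)`. -/
def sliceLeft (ω : StrongDual ℂ (H →L[ℂ] H)) (T : HTensor H H →L[ℂ] HTensor H H) : H →L[ℂ] H :=
  sliceAlong rightLeg T ω

theorem adjoint_leftLeg_tmulH (x y z : H) :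
    ContinuousLinearMap.adjoint (leftLeg x : H →L[ℂ] HTensor H H) (tmulH y z) = ⟪x, y⟫_ℂ • z := by
  refine ext_inner_left ℂ fun w => ?_
  rw [ContinuousLinearMap.adjoint_inner_right, leftLeg_apply, inner_tmulH, inner_smul_right]

theorem adjoint_rightLeg_tmulH (x y z : H) :
    ContinuousLinearMap.adjoint (rightLeg x : H →L[ℂ] HTensor H H) (tmulH y z) = ⟪x, z⟫_ℂ • y := by
  refine ext_inner_left ℂ fun w => ?_
  rw [ContinuousLinearMap.adjoint_inner_right, rightLeg_apply, inner_tmulH, inner_smul_right, mul_comm]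

/-- `(ι ⊗ ω)(a ⊗ b) = ω(b) a`. -/
theorem sliceRight_mapH (ω : StrongDual ℂ (H →L[ℂ] H)) (a b : H →L[ℂ] H) :
    sliceRight ω (mapH a b) = ω b • a := by
  ext x
  refine ext_inner_left ℂ fun y => ?_
  have h : (ContinuousLinearMap.adjoint (leftLeg y : H →L[ℂ] HTensor H H)).comp
      ((mapH a b).comp (leftLeg x)) = ⟪y, a x⟫_ℂ • b := by
    ext z; simp [adjoint_leftLeg_tmulH]
  rw [sliceRight, inner_sliceAlong, h]
  simp [inner_smul_right, mul_comm]

/-- `(ω ⊗ ι)(a ⊗ b) = ω(a) b`. -/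
theorem sliceLeft_mapH (ω : StrongDual ℂ (H →L[ℂ] H)) (a b : H →L[ℂ] H) :
    sliceLeft ω (mapH a b) = ω a • b := by
  ext x
  refine ext_inner_left ℂ fun y => ?_
  have h : (ContinuousLinearMap.adjoint (rightLeg y : H →L[ℂ] HTensor H H)).comp
      ((mapH a b).comp (rightLeg x)) = ⟪y, b x⟫_ℂ • a := by
    ext z; simp [adjoint_rightLeg_tmulH]
  rw [sliceLeft, inner_sliceAlong, h]
  simp [inner_smul_right, mul_comm]

/-! ### The algebras of a multiplicative unitary -/

/-- `S = {(ι ⊗ ω)(W) | ω ∈ B(H)_*}`. -/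
def algS (W : HTensor H H →L[ℂ] HTensor H H) : Set (H →L[ℂ] H) :=
  {s | ∃ ω ∈ predual H, sliceRight ω W = s}

/-- `Ŝ = {(ω ⊗ ι)(W) | ω ∈ B(H)_*}`. -/
def algShat (W : HTensor H H →L[ℂ] HTensor H H) : Set (H →L[ℂ] H) :=
  {s | ∃ ω ∈ predual H, sliceLeft ω W = s}

/-- `M`, the von Neumann algebra generated by `S`. -/
def algM (W : HTensor H H →L[ℂ] HTensor H H) : VonNeumannAlgebra H := generatedVN (algS W)

/-- `M̂`, the von Neumann algebra generated by `Ŝ`. -/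
def algMhat (W : HTensor H H →L[ℂ] HTensor H H) : VonNeumannAlgebra H := generatedVN (algShat W)

/-- `W` is trim: the linear span of `{s ŝ* | s ∈ S, ŝ ∈ Ŝ}` is `σ`-weakly dense in `B(H)`. -/
def IsTrim (W : HTensor H H →L[ℂ] HTensor H H) : Prop :=
  sigmaWeakClosure (Submodule.span ℂ {x : H →L[ℂ] H | ∃ s ∈ algS W, ∃ t ∈ algShat W,
    x = s * star t} : Set (H →L[ℂ] H)) = Set.univ

/-! ### Quantum group frames -/

/-- `(W, J, Ĵ)` is a quantum group frame. -/
structure IsQuantumGroupFrame (W : HTensor H H →L[ℂ] HTensor H H)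
    (J Jhat : AntiunitaryInvolution H) : Prop where
  isMultiplicativeUnitary : IsMultiplicativeUnitary W
  isTrim : IsTrim W
  star_eq : star W = (Jhat.tensor J).comp (W.comp (Jhat.tensor J))
  conj_M : ∀ m ∈ algM W, J.conjugate m ∈ (algM W).commutant
  conj_Mhat : ∀ m ∈ algMhat W, Jhat.conjugate m ∈ (algMhat W).commutant

end QGF

end

/-!
Write `S⋆` for the set of adjoints of `S`, and slice operators on `H ⊗ H` by vector functionals.
The pentagon equation in the form `W₁₂ W₁₃ = W₂₃ W₁₂ W₂₃*` shows that the `σ`-weak closure of `S` is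
an algebra.

For the adjoints, conjugate the pentagon equation by `Ĵ ⊗ Ĵ ⊗ J`. As `J M J ⊆ M'`, the operator `W`
commutes with `Ĵ J m J Ĵ ⊗ 1` for all `m ∈ M`, so trimness turns the conjugated equation into a
regularity property: the operators `(x ⊗ 1) W (1 ⊗ y)` span a `σ`-weakly dense subspace of
`B(H ⊗ H)`. Since `W₁₃ W₂₃ W₁₂* = W₁₂* W₂₃`, regularity gives `S S⋆ ⊆ closure S⋆`, that is,
`S S⋆ ⊆ closure S`; the pentagon equation also gives `S⋆ ⊆ closure (span (S S⋆))`. Hence the closure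
of `S` is a nondegenerate `*`-algebra, and by the double commutant theorem it is `M`. The assertion
on `Ŝ` is the same one for the dual frame `(Σ W* Σ, Ĵ, J)`.
-/

open scoped TensorProduct InnerProductSpace InnerProduct ComplexConjugate Topology lp

open Filter

noncomputable section

namespace QGF

section TensorOperators

variable {E F G E' F' E'' F'' X : Type*}
  [NormedAddCommGroup E] [InnerProductSpace ℂ E] [NormedAddCommGroup F] [InnerProductSpace ℂ F]
  [NormedAddCommGroup G] [InnerProductSpace ℂ G] [NormedAddCommGroup E'] [InnerProductSpace ℂ E']
  [NormedAddCommGroup F'] [InnerProductSpace ℂ F']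
  [NormedAddCommGroup E''] [InnerProductSpace ℂ E'']
  [NormedAddCommGroup F''] [InnerProductSpace ℂ F'']
  [NormedAddCommGroup X] [NormedSpace ℂ X]

theorem ext_tmulH {σ : ℂ →+* ℂ} {f g : HTensor E F →SL[σ] X}
    (h : ∀ x y, f (tmulH x y) = g (tmulH x y)) : f = g := by
  ext t
  exact mem_of_tmulH_mem (LinearMap.eqLocus f.toLinearMap g.toLinearMap)
    (isClosed_eq f.continuous g.continuous) h t

theorem map_mem_of_tmulH {σ : ℂ →+* ℂ} (f : HTensor E F →SL[σ] X) {C : Submodule ℂ X}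
    (hC : IsClosed (C : Set X)) (h : ∀ x y, f (tmulH x y) ∈ C) (t : HTensor E F) : f t ∈ C :=
  mem_of_tmulH_mem (C.comap f.toLinearMap) (hC.preimage f.continuous) h t

theorem ext_tmulH₃ {σ : ℂ →+* ℂ} {f g : HTensor E (HTensor F G) →SL[σ] X}
    (h : ∀ x y z, f (tmulH x (tmulH y z)) = g (tmulH x (tmulH y z))) : f = g := by
  refine ext_tmulH fun x t => ?_
  have hx : f.comp (leftLeg x) = g.comp (leftLeg x) := ext_tmulH fun y z => h x y z
  exact DFunLike.congr_fun hx t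

theorem eq_of_inner_tmulH {s t : HTensor E F}
    (h : ∀ x y, ⟪tmulH x y, s⟫_ℂ = ⟪tmulH x y, t⟫_ℂ) : s = t := by
  have hst : innerSL ℂ s = innerSL ℂ t := ext_tmulH fun x y => by
    simpa using congrArg conj (h x y)
  exact ext_inner_right ℂ (DFunLike.congr_fun hst)

theorem norm_tmulH (x : E) (y : F) : ‖tmulH x y‖ = ‖x‖ * ‖y‖ := by
  rw [tmulH, LinearIsometry.norm_map, TensorProduct.norm_tmul]

theorem tmulH_add (x : E) (y y' : F) : tmulH x (y + y') = tmulH x y + tmulH x y' :=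
  map_add (leftLeg x) y y'

theorem tmulH_smul (c : ℂ) (x : E) (y : F) : tmulH x (c • y) = c • tmulH x y :=
  map_smul (leftLeg x) c y

theorem smul_tmulH (c : ℂ) (x : E) (y : F) : tmulH (c • x) y = c • tmulH x y :=
  map_smul (rightLeg y) c x

theorem smul_mapH (c : ℂ) (a : E →L[ℂ] E') (b : F →L[ℂ] F') : mapH (c • a) b = c • mapH a b :=
  ext_tmulH fun x y => by simp [smul_tmulH]

theorem mapH_comp_mapH (a : E' →L[ℂ] E'') (b : F' →L[ℂ] F'') (c : E →L[ℂ] E') (d : F →L[ℂ] F') :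
    mapH a b ∘L mapH c d = mapH (a ∘L c) (b ∘L d) :=
  ext_tmulH fun x y => by simp

theorem mapH_mul (a c : E →L[ℂ] E) (b d : F →L[ℂ] F) :
    mapH a b * mapH c d = mapH (a * c) (b * d) :=
  mapH_comp_mapH a b c d

@[simp] theorem mapH_one : mapH (1 : E →L[ℂ] E) (1 : F →L[ℂ] F) = 1 :=
  ext_tmulH fun x y => by simp

theorem mapH_rankOne (x x' : E) (y y' : F) :
    mapH (InnerProductSpace.rankOne ℂ x x') (InnerProductSpace.rankOne ℂ y y') =
      InnerProductSpace.rankOne ℂ (tmulH x y) (tmulH x' y') :=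
  ext_tmulH fun u v => by simp [tmulH_smul, smul_tmulH, smul_smul, mul_comm]

theorem mapH_comp_leftLeg (a : E →L[ℂ] E') (b : F →L[ℂ] F') (x : E) :
    mapH a b ∘L leftLeg x = leftLeg (a x) ∘L b := by
  ext y; simp

theorem mapH_comp_rightLeg (a : E →L[ℂ] E') (b : F →L[ℂ] F') (y : F) :
    mapH a b ∘L rightLeg y = rightLeg (b y) ∘L a := by
  ext x; simp

@[simp] theorem flipH_comp_flipH : (flipH : HTensor F E →L[ℂ] HTensor E F) ∘L flipH = .id ℂ _ :=
  ext_tmulH fun x y => by simp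

@[simp] theorem flipH_mul_flipH : (flipH : HTensor E E →L[ℂ] HTensor E E) * flipH = 1 :=
  flipH_comp_flipH

theorem flip_rightLeg : (rightLeg : F →L[ℂ] E →L[ℂ] HTensor E F).flip = leftLeg :=
  ContinuousLinearMap.flip_flip _

theorem flipH_comp_leftLeg (x : E) : (flipH : HTensor E F →L[ℂ] _) ∘L leftLeg x = rightLeg x := by
  ext y; simp

theorem flipH_comp_rightLeg (y : F) : (flipH : HTensor E F →L[ℂ] _) ∘L rightLeg y = leftLeg y := by
  ext x; simp

theorem mapH_one_right_eq (a : E →L[ℂ] E) :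
    (mapH a 1 : HTensor E F →L[ℂ] HTensor E F) = flipH ∘L mapH 1 a ∘L flipH :=
  ext_tmulH fun x y => by simp

theorem adjoint_flipH : (flipH : HTensor E F →L[ℂ] HTensor F E)† = flipH :=
  ext_tmulH fun x y => eq_of_inner_tmulH fun x' y' => by
    simp [ContinuousLinearMap.adjoint_inner_right, mul_comm]

theorem star_flipH : star (flipH : HTensor E E →L[ℂ] HTensor E E) = flipH := adjoint_flipH

section Adjoint

variable [CompleteSpace E] [CompleteSpace F] [CompleteSpace E'] [CompleteSpace F']

theorem adjoint_mapH (a : E →L[ℂ] E') (b : F →L[ℂ] F') : (mapH a b)† = mapH (a†) (b†) :=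
  ext_tmulH fun x y => eq_of_inner_tmulH fun x' y' => by
    simp [ContinuousLinearMap.adjoint_inner_right]

theorem star_mapH (a : E →L[ℂ] E) (b : F →L[ℂ] F) : star (mapH a b) = mapH (star a) (star b) :=
  adjoint_mapH a b

end Adjoint

theorem adjoint_leftLeg_apply [CompleteSpace F] (x y : E) (z : F) :
    ((leftLeg x : F →L[ℂ] HTensor E F)†) (tmulH y z) = ⟪x, y⟫_ℂ • z := by
  refine ext_inner_left ℂ fun w => ?_
  rw [ContinuousLinearMap.adjoint_inner_right, leftLeg_apply, inner_tmulH, inner_smul_right]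

theorem adjoint_leftLeg_comp_mapH_one [CompleteSpace F] (x : E) (b : F →L[ℂ] F) :
    (leftLeg x)† ∘L mapH 1 b = b ∘L (leftLeg x)† :=
  ext_tmulH fun y z => by simp [adjoint_leftLeg_apply]

theorem adjoint_rightLeg_apply [CompleteSpace E] (x z : F) (y : E) :
    ((rightLeg x : E →L[ℂ] HTensor E F)†) (tmulH y z) = ⟪x, z⟫_ℂ • y := by
  refine ext_inner_left ℂ fun w => ?_
  rw [ContinuousLinearMap.adjoint_inner_right, rightLeg_apply, inner_tmulH, inner_smul_right,
    mul_comm]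

end TensorOperators

section Legs

variable {H : Type*} [NormedAddCommGroup H] [InnerProductSpace ℂ H]
  (S T : HTensor H H →L[ℂ] HTensor H H) (a b : H →L[ℂ] H)

@[simp] theorem leg23_tmulH (x : H) (t : HTensor H H) : leg23 T (tmulH x t) = tmulH x (T t) := by
  simp [leg23]

@[simp] theorem leg12_mapH : leg12 (mapH a b) = mapH a (mapH b 1) :=
  ext_tmulH₃ fun x y z => by simp [leg12]

@[simp] theorem leg13_mapH : leg13 (mapH a b) = mapH a (mapH 1 b) :=
  ext_tmulH₃ fun x y z => by simp [leg13]

@[simp] theorem leg23_mapH : leg23 (mapH a b) = mapH 1 (mapH a b) := rfl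

theorem leg12_mul : leg12 (S * T) = leg12 S * leg12 T := by
  have h : mapH (S * T) (1 : H →L[ℂ] H) = mapH S 1 * mapH T 1 := by rw [mapH_mul, one_mul]
  ext t
  simp only [leg12, ← ContinuousLinearMap.one_def, h]
  simp

theorem leg23_mul : leg23 (S * T) = leg23 S * leg23 T := by
  simp only [leg23, ← ContinuousLinearMap.one_def, mapH_mul, one_mul]

@[simp] theorem leg12_one : leg12 (1 : HTensor H H →L[ℂ] HTensor H H) = 1 := by
  rw [← mapH_one, leg12_mapH, mapH_one, mapH_one]

@[simp] theorem leg23_one : leg23 (1 : HTensor H H →L[ℂ] HTensor H H) = 1 := mapH_one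

theorem leg23_flipH_mul_leg23_flipH :
    leg23 flipH * leg23 flipH = (1 : _ →L[ℂ] HTensor H (HTensor H H)) := by
  rw [← leg23_mul, flipH_mul_flipH, leg23_one]

theorem leg13_mul : leg13 (S * T) = leg13 S * leg13 T := by
  calc leg23 flipH * leg12 (S * T) * leg23 flipH
      = leg23 flipH * leg12 S * 1 * leg12 T * leg23 flipH := by
        simp only [leg12_mul, mul_one, mul_assoc]
    _ = leg13 S * leg13 T := by
        simp only [← leg23_flipH_mul_leg23_flipH, leg13, mul_assoc]

@[simp] theorem leg13_one : leg13 (1 : HTensor H H →L[ℂ] HTensor H H) = 1 := by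
  rw [← mapH_one, leg13_mapH, mapH_one, mapH_one]

variable [CompleteSpace H]

theorem star_leg23 : star (leg23 T) = leg23 (star T) := by
  simp only [leg23, ← ContinuousLinearMap.one_def, star_mapH, star_one]

theorem star_leg12 : star (leg12 T) = leg12 (star T) := by
  have h : (mapH T (1 : H →L[ℂ] H))† = mapH (T†) 1 := by
    rw [adjoint_mapH, ← ContinuousLinearMap.star_eq_adjoint 1, star_one]
  simp only [leg12, ← ContinuousLinearMap.one_def, ContinuousLinearMap.star_eq_adjoint,
    ContinuousLinearMap.adjoint_comp, h, LinearIsometryEquiv.adjoint_eq_symm]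
  rfl

theorem star_leg13 : star (leg13 T) = leg13 (star T) := by
  simp only [leg13, star_mul, star_leg12, star_leg23, star_flipH, mul_assoc]

end Legs

section IdentityResolution

variable {ι ν E F K L : Type*} [NormedAddCommGroup E] [InnerProductSpace ℂ E]
  [NormedAddCommGroup F] [InnerProductSpace ℂ F]
  [NormedAddCommGroup K] [InnerProductSpace ℂ K] [CompleteSpace K]
  [NormedAddCommGroup L] [InnerProductSpace ℂ L] [CompleteSpace L]

/-- A family of bounded operators `b i` with `∑ i, b i (b i)* = 1` strongly, such as the inclusions
of the summands of an orthogonal decomposition. Normality of amplifications and density of the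
rank-one operators both come from inserting such a sum. -/
def IsIdentityResolution (b : ι → K →L[ℂ] L) : Prop :=
  ∀ ζ, HasSum (fun i => b i (((b i)†) ζ)) ζ

namespace IsIdentityResolution

variable {b : ι → K →L[ℂ] L} (hb : IsIdentityResolution b)
include hb

theorem hasSum_inner (η ζ : L) : HasSum (fun i => ⟪((b i)†) η, ((b i)†) ζ⟫_ℂ) ⟪η, ζ⟫_ℂ := by
  simpa only [ContinuousLinearMap.adjoint_inner_left, innerSL_apply_apply]
    using (hb ζ).mapL (innerSL ℂ η)

theorem hasSum_norm_sq (ζ : L) : HasSum (fun i => ‖((b i)†) ζ‖ ^ 2) (‖ζ‖ ^ 2) := by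
  simpa only [inner_self_eq_norm_sq] using RCLike.hasSum_re ℂ (hb.hasSum_inner ζ ζ)

theorem summable_norm_sq {ξ : ν → L} (hξ : Summable fun n => ‖ξ n‖ ^ 2) :
    Summable fun p : ν × ι => ‖((b p.2)†) (ξ p.1)‖ ^ 2 :=
  (summable_prod_of_nonneg fun _ => by positivity).2
    ⟨fun n => (hb.hasSum_norm_sq (ξ n)).summable, by
      simpa only [(hb.hasSum_norm_sq _).tsum_eq] using hξ⟩

end IsIdentityResolution

theorem summable_norm_mul_norm_of_sq {K : Type*} [NormedAddCommGroup K] {ξ η : ι → K}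
    (hξ : Summable fun i => ‖ξ i‖ ^ 2)
    (hη : Summable fun i => ‖η i‖ ^ 2) : Summable fun i => ‖η i‖ * ‖ξ i‖ :=
  .of_nonneg_of_le (fun _ => by positivity)
    (fun i => by nlinarith [sq_nonneg (‖η i‖ - ‖ξ i‖)]) (hη.add hξ)

theorem IsIdentityResolution.hasSum_inner_prod {b : ι → K →L[ℂ] L} (hb : IsIdentityResolution b)
    {ξ η : ν → L} (hξ : Summable fun n => ‖ξ n‖ ^ 2) (hη : Summable fun n => ‖η n‖ ^ 2) {c : ℂ}
    (hc : HasSum (fun n => ⟪η n, ξ n⟫_ℂ) c) :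
    HasSum (fun p : ν × ι => ⟪((b p.2)†) (η p.1), ((b p.2)†) (ξ p.1)⟫_ℂ) c := by
  have hs : Summable fun p : ν × ι => ⟪((b p.2)†) (η p.1), ((b p.2)†) (ξ p.1)⟫_ℂ :=
    .of_norm_bounded
      (summable_norm_mul_norm_of_sq (hb.summable_norm_sq hξ) (hb.summable_norm_sq hη))
      fun _ => norm_inner_le_norm _ _
  exact (hs.hasSum.prod_fiberwise fun n => hb.hasSum_inner (η n) (ξ n)).unique hc ▸ hs.hasSum

theorem isIdentityResolution_toSpanSingleton (e : HilbertBasis ι ℂ K) :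
    IsIdentityResolution fun i => ContinuousLinearMap.toSpanSingleton ℂ (e i) := fun ζ => by
  simpa [ContinuousLinearMap.adjoint_toSpanSingleton, e.repr_apply_apply] using e.hasSum_repr ζ

theorem adjoint_apply_of_isHilbertSum {V : ι → K →ₗᵢ[ℂ] L} (hV : IsHilbertSum ℂ (fun _ => K) V)
    (u : L) (i : ι) : ((V i).toContinuousLinearMap†) u = hV.linearIsometryEquiv u i := by
  classical
  refine ext_inner_left ℂ fun x => ?_
  refine .trans ?_ (lp.inner_single_left (G := fun _ => K) i x (hV.linearIsometryEquiv u))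
  rw [← hV.linearIsometryEquiv.symm.inner_map_map, hV.linearIsometryEquiv_symm_apply_single,
    LinearIsometryEquiv.symm_apply_apply, ContinuousLinearMap.adjoint_inner_right]
  rfl

theorem isIdentityResolution_of_isHilbertSum {V : ι → K →ₗᵢ[ℂ] L}
    (hV : IsHilbertSum ℂ (fun _ => K) V) :
    IsIdentityResolution fun i => (V i).toContinuousLinearMap := fun ζ => by
  simpa [adjoint_apply_of_isHilbertSum hV] using
    hV.hasSum_linearIsometryEquiv_symm (hV.linearIsometryEquiv ζ)

/-- `leftLeg x` as an isometry, for a unit vector `x`. -/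
def leftLegIsometry {x : E} (hx : ‖x‖ = 1) : F →ₗᵢ[ℂ] HTensor E F where
  toLinearMap := (leftLeg x : F →L[ℂ] HTensor E F)
  norm_map' y := by simp [norm_tmulH, hx]

theorem isHilbertSum_leftLeg (e : HilbertBasis ι ℂ E) :
    IsHilbertSum ℂ (fun _ => L) fun i => leftLegIsometry (F := L) (e.orthonormal.1 i) := by
  refine .mk (fun i j hij y y' => ?_) fun t _ => ?_
  · simp [leftLegIsometry, e.orthonormal.2 hij]
  · refine mem_of_tmulH_mem _ (Submodule.isClosed_topologicalClosure _) (fun x y => ?_) t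
    let p := (⨆ i, LinearMap.range
      (leftLegIsometry (F := L) (e.orthonormal.1 i)).toLinearMap).topologicalClosure
    have he : (Submodule.span ℂ (Set.range e)).topologicalClosure ≤
        p.comap (rightLeg y : E →L[ℂ] HTensor E L).toLinearMap := by
      refine Submodule.topologicalClosure_minimal _ (Submodule.span_le.2 ?_)
        ((Submodule.isClosed_topologicalClosure _).preimage (rightLeg y).continuous)
      rintro _ ⟨i, rfl⟩
      exact Submodule.le_topologicalClosure _ (Submodule.mem_iSup_of_mem i ⟨y, rfl⟩)
    exact he (e.dense_span ▸ Submodule.mem_top)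

theorem exists_adjoint_leftLeg_eq (e : HilbertBasis ι ℂ E) {ξ : ι → L}
    (hξ : Summable fun i => ‖ξ i‖ ^ 2) :
    ∃ u, ∀ i, ((leftLeg (e i) : L →L[ℂ] HTensor E L)†) u = ξ i := by
  have hV := isHilbertSum_leftLeg (L := L) e
  have hξ' : Memℓp ξ 2 := memℓp_gen (by simpa using hξ)
  refine ⟨hV.linearIsometryEquiv.symm ⟨ξ, hξ'⟩, fun i => ?_⟩
  exact (adjoint_apply_of_isHilbertSum hV _ i).trans
    (by rw [LinearIsometryEquiv.apply_symm_apply])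

theorem isIdentityResolution_leftLeg (e : HilbertBasis ι ℂ E) :
    IsIdentityResolution fun i => (leftLeg (e i) : L →L[ℂ] HTensor E L) := by
  have h : ∀ i, (leftLegIsometry (F := L) (e.orthonormal.1 i)).toContinuousLinearMap =
    leftLeg (e i) := fun _ => rfl
  simpa only [h] using isIdentityResolution_of_isHilbertSum (isHilbertSum_leftLeg (L := L) e)

end IdentityResolution

section Predual

variable {H : Type*} [NormedAddCommGroup H] [InnerProductSpace ℂ H]

/-- The functional `x ↦ ⟪p, x q⟫`. -/
def vectorFunctional (p q : H) : StrongDual ℂ (H →L[ℂ] H) :=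
  innerSL ℂ p ∘L ContinuousLinearMap.apply ℂ H q

@[simp] theorem vectorFunctional_apply (p q : H) (x : H →L[ℂ] H) :
    vectorFunctional p q x = ⟪p, x q⟫_ℂ := rfl

theorem norm_vectorFunctional_le (p q : H) : ‖vectorFunctional p q‖ ≤ ‖p‖ * ‖q‖ := by
  refine ContinuousLinearMap.opNorm_le_bound _ (by positivity) fun x => ?_
  calc ‖⟪p, x q⟫_ℂ‖ ≤ ‖p‖ * ‖x q‖ := norm_inner_le_norm _ _
    _ ≤ ‖p‖ * (‖x‖ * ‖q‖) := by gcongr; exact x.le_opNorm q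
    _ = ‖p‖ * ‖q‖ * ‖x‖ := by ring

theorem mem_predual_of_hasSum {ι : Type*} {ω : StrongDual ℂ (H →L[ℂ] H)} {ξ η : ι → H}
    (hξ : Summable fun i => ‖ξ i‖ ^ 2) (hη : Summable fun i => ‖η i‖ ^ 2)
    (h : ∀ x : H →L[ℂ] H, HasSum (fun i => ⟪η i, x (ξ i)⟫_ℂ) (ω x)) : ω ∈ predual H := by
  let s : Set ι := Function.support fun i => ‖ξ i‖ ^ 2
  obtain ⟨e, he⟩ := hξ.countable_support.exists_injective_nat
  have hξs : ∀ i ∉ Set.range ((↑) : s → ι), ξ i = 0 := fun i hi => by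
    simpa [s] using hi
  have hext : ∀ (f : s → H) (n : ℕ), n ∉ Set.range e → Function.extend e f 0 n = 0 :=
    fun f n hn => Function.extend_apply' _ _ _ (by simpa using hn)
  refine ⟨Function.extend e (fun i => ξ i) 0, Function.extend e (fun i => η i) 0, ?_, ?_,
    fun x => ?_⟩
  · rw [← he.summable_iff fun n hn => by simp [hext _ n hn]]
    simpa [Function.comp_def, he.extend_apply] using hξ.comp_injective Subtype.val_injective
  · rw [← he.summable_iff fun n hn => by simp [hext _ n hn]]
    simpa [Function.comp_def, he.extend_apply] using hη.comp_injective Subtype.val_injective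
  · rw [← he.hasSum_iff fun n hn => by simp [hext _ n hn]]
    simpa [Function.comp_def, he.extend_apply] using
      (Subtype.val_injective.hasSum_iff fun i hi => by simp [hξs i hi]).2 (h x)

theorem exists_mem_predual {ι : Type*} {ξ η : ι → H} (hξ : Summable fun i => ‖ξ i‖ ^ 2)
    (hη : Summable fun i => ‖η i‖ ^ 2) :
    ∃ ω ∈ predual H, ∀ x : H →L[ℂ] H, HasSum (fun i => ⟪η i, x (ξ i)⟫_ℂ) (ω x) := by
  obtain ⟨ω, hω⟩ : Summable fun i => vectorFunctional (η i) (ξ i) :=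
    .of_norm_bounded (E := StrongDual ℂ (H →L[ℂ] H)) (summable_norm_mul_norm_of_sq hξ hη)
      fun i => norm_vectorFunctional_le (η i) (ξ i)
  have hsum : ∀ x, HasSum (fun i => ⟪η i, x (ξ i)⟫_ℂ) (ω x) := fun x =>
    hω.mapL (ContinuousLinearMap.apply ℂ ℂ x)
  exact ⟨ω, mem_predual_of_hasSum hξ hη hsum, hsum⟩

theorem vectorFunctional_mem_predual (p q : H) : vectorFunctional p q ∈ predual H :=
  mem_predual_of_hasSum (ι := Unit) (ξ := fun _ => q) (η := fun _ => p) .of_finite .of_finite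
    fun x => hasSum_unique fun _ => ⟪p, x q⟫_ℂ

variable (H) in
/-- The predual as a subspace of the dual of `B(H)`. -/
def predualSubmodule : Submodule ℂ (StrongDual ℂ (H →L[ℂ] H)) where
  carrier := predual H
  zero_mem' := ⟨0, 0, by simp [summable_zero], by simp [summable_zero], by simp [hasSum_zero]⟩
  smul_mem' := by
    rintro c ω ⟨ξ, η, hξ, hη, hω⟩
    refine ⟨fun n => c • ξ n, η, ?_, hη, fun x => ?_⟩
    · simpa only [norm_smul, mul_pow] using hξ.mul_left (‖c‖ ^ 2)
    · simpa [inner_smul_right] using (hω x).mul_left c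
  add_mem' := by
    rintro ω ω' ⟨ξ, η, hξ, hη, hω⟩ ⟨ξ', η', hξ', hη', hω'⟩
    refine mem_predual_of_hasSum (ι := ℕ ⊕ ℕ) (ξ := Sum.elim ξ ξ') (η := Sum.elim η η')
      (Summable.sum _ hξ hξ') (Summable.sum _ hη hη') fun x => HasSum.sum (hω x) (hω' x)

end Predual

section SigmaWeak

variable {H : Type*} [NormedAddCommGroup H] [InnerProductSpace ℂ H]

theorem continuous_sigmaWeak {ω : StrongDual ℂ (H →L[ℂ] H)} (hω : ω ∈ predual H) :
    Continuous[sigmaWeakTopology H, _] ω :=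
  let _ := sigmaWeakTopology H
  (continuous_apply (⟨ω, hω⟩ : predual H)).comp
    (continuous_induced_dom (f := fun (x : H →L[ℂ] H) (ω : predual H) => ω.1 x))

theorem tendsto_sigmaWeak_iff {ι : Type*} {f : ι → H →L[ℂ] H} {l : Filter ι} {x : H →L[ℂ] H} :
    Tendsto f l (@nhds _ (sigmaWeakTopology H) x) ↔
      ∀ ω ∈ predual H, Tendsto (fun i => ω (f i)) l (𝓝 (ω x)) := by
  rw [nhds_induced, tendsto_comap_iff, tendsto_pi_nhds, Subtype.forall]
  rfl

theorem continuous_sigmaWeak_rng_iff {X : Type*} [TopologicalSpace X] {f : X → H →L[ℂ] H} :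
    Continuous[_, sigmaWeakTopology H] f ↔ ∀ ω ∈ predual H, Continuous fun x => ω (f x) := by
  rw [continuous_induced_rng, continuous_pi_iff, Subtype.forall]
  rfl

theorem isClosed_of_isClosed_sigmaWeak {C : Set (H →L[ℂ] H)}
    (hC : IsClosed[sigmaWeakTopology H] C) : IsClosed C :=
  hC.mono (continuous_iff_le_induced.1 <| continuous_pi fun ω => ω.1.continuous)

theorem mem_closure_induced_iff {E F : Type*} [AddCommGroup E] [Module ℂ E]
    [AddCommGroup F] [Module ℂ F] (B : E →ₗ[ℂ] F →ₗ[ℂ] ℂ) (C : Submodule ℂ E) (x : E) :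
    x ∈ @closure _ (.induced (fun x y => B x y) Pi.topologicalSpace) (C : Set E) ↔
      ∀ y, (∀ a ∈ C, B a y = 0) → B x y = 0 := by
  let _ : Module ℝ E := .complexToReal E
  let _ : TopologicalSpace E := .induced (fun x y => B x y) Pi.topologicalSpace
  have : B.IsWeak := ⟨rfl⟩
  have := LinearMap.IsWeak.isTopologicalAddGroup B
  have := LinearMap.IsWeak.continuousSMul B
  have : LocallyConvexSpace ℝ E := inferInstanceAs (LocallyConvexSpace ℝ (WeakBilin B))
  refine ⟨fun hx y hy => closure_minimal hy
    (isClosed_eq (LinearMap.IsWeak.continuous_eval B y) continuous_const) hx, fun h => ?_⟩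
  by_contra hx
  obtain ⟨f, u, hfC, hfx⟩ := RCLike.geometric_hahn_banach_closed_point
    (𝕜 := ℂ) (C.topologicalClosure.restrictScalars ℝ).convex C.isClosed_topologicalClosure hx
  obtain ⟨y, rfl⟩ := B.dualEmbedding_surjective f
  -- A functional whose real part is bounded above on a subspace vanishes there.
  have hy : ∀ a ∈ C, B a y = 0 := fun a ha => by
    by_contra h
    have hua : RCLike.re (B ((u / B a y : ℂ) • a) y) < u := hfC _ (subset_closure (C.smul_mem _ ha))
    simp [h] at hua
  have hu : RCLike.re (B 0 y) < u := hfC 0 (subset_closure C.zero_mem)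
  have hux : u < RCLike.re (B x y) := hfx
  simp only [h y hy, map_zero, LinearMap.zero_apply] at hu hux
  exact hu.not_gt hux

theorem mem_sigmaWeakClosure_iff (C : Submodule ℂ (H →L[ℂ] H)) (x : H →L[ℂ] H) :
    x ∈ sigmaWeakClosure (C : Set (H →L[ℂ] H)) ↔
      ∀ ω ∈ predual H, (∀ a ∈ C, ω a = 0) → ω x = 0 := by
  let B : (H →L[ℂ] H) →ₗ[ℂ] predualSubmodule H →ₗ[ℂ] ℂ :=
    (ContinuousLinearMap.coeLM ℂ ∘ₗ (predualSubmodule H).subtype).flip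
  refine (mem_closure_induced_iff (F := predualSubmodule H) B C x).trans ?_
  exact Subtype.forall

/-- The `σ`-weak closure of a subspace. -/
def sigmaWeakClosureSubmodule (C : Submodule ℂ (H →L[ℂ] H)) : Submodule ℂ (H →L[ℂ] H) where
  carrier := sigmaWeakClosure C
  zero_mem' := (mem_sigmaWeakClosure_iff C 0).2 fun ω _ _ => map_zero ω
  add_mem' hx hy := (mem_sigmaWeakClosure_iff C _).2 fun ω hω h => by
    rw [map_add, (mem_sigmaWeakClosure_iff C _).1 hx ω hω h,
      (mem_sigmaWeakClosure_iff C _).1 hy ω hω h, add_zero]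
  smul_mem' c x hx := (mem_sigmaWeakClosure_iff C _).2 fun ω hω h => by
    rw [map_smul, (mem_sigmaWeakClosure_iff C _).1 hx ω hω h, smul_zero]

theorem isClosed_sigmaWeakClosure (s : Set (H →L[ℂ] H)) :
    IsClosed[sigmaWeakTopology H] (sigmaWeakClosure s) :=
  @isClosed_closure _ (sigmaWeakTopology H) s

theorem subset_sigmaWeakClosure (s : Set (H →L[ℂ] H)) : s ⊆ sigmaWeakClosure s :=
  @subset_closure _ (sigmaWeakTopology H) s

theorem sigmaWeakClosure_subset {s t : Set (H →L[ℂ] H)} (hst : s ⊆ t)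
    (ht : IsClosed[sigmaWeakTopology H] t) : sigmaWeakClosure s ⊆ t :=
  @closure_minimal _ (sigmaWeakTopology H) s t hst ht

theorem IsIdentityResolution.tendsto_sigmaWeak [CompleteSpace H] {ι K : Type*}
    [NormedAddCommGroup K] [InnerProductSpace ℂ K] [CompleteSpace K] {b : ι → K →L[ℂ] H}
    (hb : IsIdentityResolution b) :
    Tendsto (fun s => ∑ i ∈ s, b i ∘L (b i)†) atTop (@nhds _ (sigmaWeakTopology H) 1) := by
  refine tendsto_sigmaWeak_iff.2 ?_
  rintro ω ⟨ξ, η, hξ, hη, hω⟩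
  simp only [map_sum]
  have hsum := (Equiv.prodComm ι ℕ).hasSum_iff.2 (hb.hasSum_inner_prod hξ hη (hω 1))
  refine hsum.prod_fiberwise fun i => ?_
  simpa [ContinuousLinearMap.adjoint_inner_left] using hω (b i ∘L (b i)†)

end SigmaWeak

section Normal

variable {E F K L N : Type*} [NormedAddCommGroup E] [InnerProductSpace ℂ E]
  [NormedAddCommGroup F] [InnerProductSpace ℂ F]
  [NormedAddCommGroup K] [InnerProductSpace ℂ K]
  [NormedAddCommGroup L] [InnerProductSpace ℂ L]
  [NormedAddCommGroup N] [InnerProductSpace ℂ N]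

/-- `Φ` is a `σ`-weakly continuous linear map between algebras of bounded operators. It is a
predicate on functions rather than a bundled map so that formulas such as `x ↦ a * mapH x 1` can be
shown to be normal compositionally. -/
structure IsNormalMap (Φ : (K →L[ℂ] K) → L →L[ℂ] L) : Prop where
  isLinearMap : IsLinearMap ℂ Φ
  continuous : Continuous[sigmaWeakTopology K, sigmaWeakTopology L] Φ

namespace IsNormalMap

theorem of_predual {Φ : (K →L[ℂ] K) → L →L[ℂ] L} (hΦ : IsLinearMap ℂ Φ)
    (h : ∀ ω ∈ predual L, ∃ ω' ∈ predual K, ∀ x, ω (Φ x) = ω' x) : IsNormalMap Φ where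
  isLinearMap := hΦ
  continuous := by
    let _ := sigmaWeakTopology K
    refine continuous_sigmaWeak_rng_iff.2 fun ω hω => ?_
    obtain ⟨ω', hω', h⟩ := h ω hω
    simpa only [h] using continuous_sigmaWeak hω'

theorem id : IsNormalMap fun x : K →L[ℂ] K => x where
  isLinearMap := ⟨fun _ _ => rfl, fun _ _ => rfl⟩
  continuous := @continuous_id _ (sigmaWeakTopology K)

theorem comp {Ψ : (L →L[ℂ] L) → N →L[ℂ] N} {Φ : (K →L[ℂ] K) → L →L[ℂ] L}
    (hΨ : IsNormalMap Ψ) (hΦ : IsNormalMap Φ) : IsNormalMap fun x => Ψ (Φ x) where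
  isLinearMap := (hΨ.isLinearMap.mk' Ψ ∘ₗ hΦ.isLinearMap.mk' Φ).isLinear
  continuous := @Continuous.comp _ _ _ (sigmaWeakTopology K) (sigmaWeakTopology L)
    (sigmaWeakTopology N) _ _ hΨ.continuous hΦ.continuous

variable {Φ : (K →L[ℂ] K) → L →L[ℂ] L}

theorem comp_comp [CompleteSpace L] [CompleteSpace N] (hΦ : IsNormalMap Φ) (P : L →L[ℂ] N)
    (Q : N →L[ℂ] L) : IsNormalMap fun x => P ∘L Φ x ∘L Q := by
  have hPQ : IsLinearMap ℂ fun x : L →L[ℂ] L => P ∘L x ∘L Q :=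
    ⟨fun _ _ => by ext; simp, fun _ _ => by ext; simp⟩
  refine comp (of_predual hPQ ?_) hΦ
  rintro ω ⟨ξ, η, hξ, hη, hω⟩
  have norm_sq_summable : ∀ (T : N →L[ℂ] L) {ζ : ℕ → N}, (Summable fun n => ‖ζ n‖ ^ 2) →
      Summable fun n => ‖T (ζ n)‖ ^ 2 := fun T ζ hζ =>
    (hζ.mul_left (‖T‖ ^ 2)).of_nonneg_of_le (fun _ => by positivity) fun n => by
      rw [← mul_pow]; gcongr; exact T.le_opNorm _
  obtain ⟨ω', hω', hω'x⟩ := exists_mem_predual (norm_sq_summable Q hξ) (norm_sq_summable (P†) hη)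
  refine ⟨ω', hω', fun x => (hω _).unique ?_⟩
  simpa only [ContinuousLinearMap.adjoint_inner_left, ContinuousLinearMap.comp_apply] using hω'x x

theorem const_mul [CompleteSpace L] (hΦ : IsNormalMap Φ) (a : L →L[ℂ] L) :
    IsNormalMap fun x => a * Φ x :=
  hΦ.comp_comp a 1

theorem mul_const [CompleteSpace L] (hΦ : IsNormalMap Φ) (a : L →L[ℂ] L) :
    IsNormalMap fun x => Φ x * a :=
  hΦ.comp_comp 1 a

theorem mem_of_mem_sigmaWeakClosure (hΦ : IsNormalMap Φ) {s : Set (K →L[ℂ] K)}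
    {t : Set (L →L[ℂ] L)} (ht : IsClosed[sigmaWeakTopology L] t) (h : ∀ x ∈ s, Φ x ∈ t)
    {x : K →L[ℂ] K} (hx : x ∈ sigmaWeakClosure s) : Φ x ∈ t :=
  sigmaWeakClosure_subset h (@IsClosed.preimage _ _ (sigmaWeakTopology K) (sigmaWeakTopology L)
    _ hΦ.continuous _ ht) hx

theorem isClosed_comap (hΦ : IsNormalMap Φ) {C : Submodule ℂ (L →L[ℂ] L)}
    (hC : IsClosed[sigmaWeakTopology L] (C : Set (L →L[ℂ] L))) :
    IsClosed[sigmaWeakTopology K] (C.comap (hΦ.isLinearMap.mk' Φ) : Set (K →L[ℂ] K)) :=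
  @IsClosed.preimage _ _ (sigmaWeakTopology K) (sigmaWeakTopology L) _ hΦ.continuous _ hC

end IsNormalMap

theorem IsIdentityResolution.isNormalMap [CompleteSpace K] [CompleteSpace L] {ι : Type*}
    {b : ι → K →L[ℂ] L} (hb : IsIdentityResolution b) {Φ : (K →L[ℂ] K) → L →L[ℂ] L}
    (hΦ : IsLinearMap ℂ Φ) (h : ∀ x i, (b i)† ∘L Φ x = x ∘L (b i)†) : IsNormalMap Φ := by
  refine .of_predual hΦ ?_
  rintro ω ⟨ξ, η, hξ, hη, hω⟩
  obtain ⟨ω', hω', hω'x⟩ := exists_mem_predual (hb.summable_norm_sq hξ) (hb.summable_norm_sq hη)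
  refine ⟨ω', hω', fun x => HasSum.unique ?_ (hω'x x)⟩
  have hΦξ : ∀ n i, ((b i)†) (Φ x (ξ n)) = x (((b i)†) (ξ n)) := fun n i =>
    DFunLike.congr_fun (h x i) (ξ n)
  have hs : Summable fun n => ‖Φ x (ξ n)‖ ^ 2 :=
    (hξ.mul_left (‖Φ x‖ ^ 2)).of_nonneg_of_le (fun _ => by positivity) fun n => by
      rw [← mul_pow]; gcongr; exact (Φ x).le_opNorm _
  simpa only [hΦξ] using hb.hasSum_inner_prod hs hη (hω (Φ x))

theorem t2Space_sigmaWeak : @T2Space (K →L[ℂ] K) (sigmaWeakTopology K) := by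
  let _ := sigmaWeakTopology K
  refine ⟨fun x y hxy => ?_⟩
  obtain ⟨q, hq⟩ := DFunLike.ne_iff.1 hxy
  have hpq : ∃ p, ⟪p, x q⟫_ℂ ≠ ⟪p, y q⟫_ℂ := by
    contrapose! hq
    exact ext_inner_left ℂ hq
  obtain ⟨p, hp⟩ := hpq
  exact separated_by_continuous (continuous_sigmaWeak (vectorFunctional_mem_predual p q)) hp

theorem continuous_star_sigmaWeak [CompleteSpace K] :
    Continuous[sigmaWeakTopology K, sigmaWeakTopology K] star := by
  let _ := sigmaWeakTopology K
  refine continuous_sigmaWeak_rng_iff.2 ?_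
  rintro ω ⟨ξ, η, hξ, hη, hω⟩
  obtain ⟨ω', hω', hω'x⟩ := exists_mem_predual hη hξ
  have hstar : (fun x => ω (star x)) = fun x => conj (ω' x) := funext fun x =>
    (hω (star x)).unique <| by
      simpa [ContinuousLinearMap.star_eq_adjoint, ContinuousLinearMap.adjoint_inner_right]
        using (hω'x x).star
  rw [hstar]
  exact Complex.continuous_conj.comp (continuous_sigmaWeak hω')

theorem toSpanSingleton_comp_adjoint_mul [CompleteSpace K] (X : K →L[ℂ] K) (p : K) :
    (ContinuousLinearMap.toSpanSingleton ℂ p ∘L (ContinuousLinearMap.toSpanSingleton ℂ p)†) * X =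
      InnerProductSpace.rankOne ℂ p ((X†) p) := by
  ext q
  simp [ContinuousLinearMap.adjoint_toSpanSingleton, ContinuousLinearMap.adjoint_inner_left]

theorem mem_of_rankOne_mem [CompleteSpace K] {C : Submodule ℂ (K →L[ℂ] K)}
    (hC : IsClosed[sigmaWeakTopology K] (C : Set (K →L[ℂ] K)))
    (h : ∀ p q, InnerProductSpace.rankOne ℂ p q ∈ C) (X : K →L[ℂ] K) : X ∈ C := by
  let _ := sigmaWeakTopology K
  obtain ⟨w, e, -⟩ := exists_hilbertBasis ℂ K
  have hlim := ((IsNormalMap.id.mul_const X).continuous.tendsto 1).comp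
    (isIdentityResolution_toSpanSingleton e).tendsto_sigmaWeak
  simp only [Function.comp_def, Finset.sum_mul, toSpanSingleton_comp_adjoint_mul, one_mul] at hlim
  exact hC.mem_of_tendsto hlim (.of_forall fun s => C.sum_mem fun i _ => h _ _)

theorem mem_of_mapH_mem {C : Submodule ℂ (HTensor E F →L[ℂ] HTensor E F)}
    (hC : IsClosed[sigmaWeakTopology (HTensor E F)] (C : Set (HTensor E F →L[ℂ] HTensor E F)))
    (h : ∀ a b, mapH a b ∈ C) (X : HTensor E F →L[ℂ] HTensor E F) : X ∈ C := by
  have hC' := isClosed_of_isClosed_sigmaWeak hC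
  have hleft : ∀ s x' y', InnerProductSpace.rankOne ℂ s (tmulH x' y') ∈ C := by
    intro s x' y'
    let f : HTensor E F →L[ℂ] HTensor E F →L[ℂ] HTensor E F :=
      (InnerProductSpace.rankOne ℂ).flip (tmulH x' y')
    refine map_mem_of_tmulH f hC' (fun x y => ?_) s
    rw [ContinuousLinearMap.flip_apply, ← mapH_rankOne]
    exact h _ _
  exact mem_of_rankOne_mem hC
    (fun s t => map_mem_of_tmulH (InnerProductSpace.rankOne ℂ s) hC' (hleft s) t) X

namespace IsNormalMap

variable {Φ Ψ : (HTensor E F →L[ℂ] HTensor E F) → L →L[ℂ] L}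

theorem mem_of_mapH (hΦ : IsNormalMap Φ) {C : Submodule ℂ (L →L[ℂ] L)}
    (hC : IsClosed[sigmaWeakTopology L] (C : Set (L →L[ℂ] L))) (h : ∀ a b, Φ (mapH a b) ∈ C)
    (X : HTensor E F →L[ℂ] HTensor E F) : Φ X ∈ C :=
  mem_of_mapH_mem (hΦ.isClosed_comap hC) h X

theorem ext_mapH (hΦ : IsNormalMap Φ) (hΨ : IsNormalMap Ψ)
    (h : ∀ a b, Φ (mapH a b) = Ψ (mapH a b)) (X : HTensor E F →L[ℂ] HTensor E F) : Φ X = Ψ X :=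
  mem_of_mapH_mem (C := LinearMap.eqLocus (hΦ.isLinearMap.mk' Φ) (hΨ.isLinearMap.mk' Ψ))
    (@isClosed_eq _ _ (sigmaWeakTopology L) (sigmaWeakTopology _) t2Space_sigmaWeak _ _
      hΦ.continuous hΨ.continuous) h X

end IsNormalMap

variable [CompleteSpace E] [CompleteSpace F]

variable (E F) in
theorem isNormalMap_mapH_one_left :
    IsNormalMap fun b : F →L[ℂ] F => (mapH 1 b : HTensor E F →L[ℂ] HTensor E F) := by
  obtain ⟨w, e, -⟩ := exists_hilbertBasis ℂ E
  refine (isIdentityResolution_leftLeg e).isNormalMap ⟨fun _ _ => ?_, fun _ _ => ?_⟩ fun b i => ?_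
  · exact ext_tmulH fun x y => by simp [tmulH_add]
  · exact ext_tmulH fun x y => by simp [tmulH_smul]
  · exact adjoint_leftLeg_comp_mapH_one (e i) b

namespace IsNormalMap

theorem mapH_one_left {Φ : (K →L[ℂ] K) → F →L[ℂ] F} (hΦ : IsNormalMap Φ) :
    IsNormalMap fun x => (mapH 1 (Φ x) : HTensor E F →L[ℂ] HTensor E F) :=
  (isNormalMap_mapH_one_left E F).comp hΦ

theorem mapH_one_right {Φ : (K →L[ℂ] K) → E →L[ℂ] E} (hΦ : IsNormalMap Φ) :
    IsNormalMap fun x => (mapH (Φ x) 1 : HTensor E F →L[ℂ] HTensor E F) := by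
  simp only [mapH_one_right_eq]
  exact hΦ.mapH_one_left.comp_comp flipH flipH

variable {Φ : (K →L[ℂ] K) → HTensor E E →L[ℂ] HTensor E E}

theorem leg23 (hΦ : IsNormalMap Φ) : IsNormalMap fun x => leg23 (Φ x) := hΦ.mapH_one_left

theorem leg12 (hΦ : IsNormalMap Φ) : IsNormalMap fun x => leg12 (Φ x) :=
  (hΦ.mapH_one_right (F := E)).comp_comp _ _

theorem leg13 (hΦ : IsNormalMap Φ) : IsNormalMap fun x => leg13 (Φ x) :=
  (hΦ.leg12.const_mul _).mul_const _

end IsNormalMap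

end Normal

section DoubleCommutant

variable {L K : Type*} [NormedAddCommGroup K] [InnerProductSpace ℂ K] [CompleteSpace K]
  [NormedAddCommGroup L] [InnerProductSpace ℂ L]

open Module.End in
theorem starProjection_mem_centralizer {A : Set (K →L[ℂ] K)} (hA : ∀ a ∈ A, star a ∈ A)
    {U : Submodule ℂ K} [U.HasOrthogonalProjection] (hU : ∀ a ∈ A, ∀ t ∈ U, a t ∈ U) :
    U.starProjection ∈ A.centralizer := fun a ha => by
  have hinv : ∀ b ∈ A, U ∈ invtSubmodule (b : K →ₗ[ℂ] K) := fun b hb =>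
    (mem_invtSubmodule_iff_forall_mem_of_mem _).2 (hU b hb)
  refine ((ContinuousLinearMap.IsIdempotentElem.commute_iff
    U.isIdempotentElem_starProjection).2 ⟨?_, ?_⟩).symm
  · rw [Submodule.range_starProjection]
    exact hinv a ha
  · rw [Submodule.ker_starProjection]
    exact ContinuousLinearMap.orthogonal_mem_invtSubmodule (hinv _ (hA a ha))

section

variable (A : NonUnitalStarSubalgebra ℂ (K →L[ℂ] K)) (hA : ∀ h, (∀ a ∈ A, a h = 0) → h = 0)
include hA

theorem apply_mem_closure_of_mem_centralizer_centralizer {x : K →L[ℂ] K}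
    (hx : x ∈ (A : Set (K →L[ℂ] K)).centralizer.centralizer) (u : K) :
    x u ∈ closure ((fun a : K →L[ℂ] K => a u) '' A) := by
  let U := (A.toSubmodule.map (ContinuousLinearMap.apply ℂ K u).toLinearMap).topologicalClosure
  have hAU : ∀ a ∈ A, a u ∈ U := fun a ha =>
    Submodule.le_topologicalClosure _ ⟨a, ha, rfl⟩
  have hU : ∀ a ∈ A, ∀ t ∈ U, a t ∈ U := fun a ha =>
    Submodule.topologicalClosure_minimal (t := U.comap (a : K →ₗ[ℂ] K)) _
      (by rintro _ ⟨b, hb, rfl⟩; exact hAU (a * b) (A.mul_mem ha hb))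
      ((Submodule.isClosed_topologicalClosure _).preimage a.continuous)
  have hP : U.starProjection ∈ (A : Set (K →L[ℂ] K)).centralizer :=
    starProjection_mem_centralizer (fun a => star_mem) hU
  have hu : u ∈ U := by
    refine Submodule.starProjection_eq_self_iff.1 (sub_eq_zero.1 (hA _ fun a ha => ?_))
    rw [map_sub, sub_eq_zero, ← mul_apply_eq_comp, hP a ha,
      mul_apply_eq_comp, Submodule.starProjection_eq_self_iff.2 (hAU a ha)]
  have hxu : x u ∈ U := by
    rw [← Submodule.starProjection_eq_self_iff, ← mul_apply_eq_comp, hx _ hP,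
      mul_apply_eq_comp, Submodule.starProjection_eq_self_iff.2 hu]
  exact hxu

end

variable [CompleteSpace L]

variable (L K) in
/-- The amplification `x ↦ 1 ⊗ x`. -/
def amplify : (K →L[ℂ] K) →⋆ₐ[ℂ] HTensor L K →L[ℂ] HTensor L K where
  toFun x := mapH 1 x
  map_one' := mapH_one
  map_mul' x y := by rw [mapH_mul, one_mul]
  map_zero' := ext_tmulH fun s t => by simpa using map_zero (leftLeg s)
  map_add' x y := ext_tmulH fun s t => by simp [tmulH_add]
  commutes' c := ext_tmulH fun s t => by simp [Algebra.algebraMap_eq_smul_one, tmulH_smul]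
  map_star' x := by rw [star_mapH, star_one]

theorem amplify_apply (x : K →L[ℂ] K) : amplify L K x = mapH 1 x := rfl

theorem adjoint_leftLeg_amplify_apply (l : L) (x : K →L[ℂ] K) (t : HTensor L K) :
    ((leftLeg l)†) (amplify L K x t) = x (((leftLeg l)†) t) :=
  DFunLike.congr_fun (adjoint_leftLeg_comp_mapH_one l x) t

theorem amplify_mem_centralizer_centralizer {A : Set (K →L[ℂ] K)} {x : K →L[ℂ] K}
    (hx : x ∈ A.centralizer.centralizer) :
    amplify L K x ∈ (amplify L K '' A).centralizer.centralizer := by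
  intro P hP
  have hcomp : ∀ l l', (leftLeg l)† ∘L P ∘L leftLeg l' ∈ A.centralizer := by
    intro l l' a ha
    ext h
    have hPa : P (tmulH l' (a h)) = amplify L K a (P (tmulH l' h)) := by
      simpa [amplify_apply] using (DFunLike.congr_fun (hP _ ⟨a, ha, rfl⟩) (tmulH l' h)).symm
    simp [hPa, adjoint_leftLeg_amplify_apply]
  refine ext_tmulH fun l' h' => eq_of_inner_tmulH fun l h => ?_
  have hl := DFunLike.congr_fun (hx _ (hcomp l l')) h'
  simp only [mul_apply_eq_comp, ContinuousLinearMap.comp_apply, leftLeg_apply] at hl ⊢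
  rw [← leftLeg_apply l h, ← ContinuousLinearMap.adjoint_inner_right,
    ← ContinuousLinearMap.adjoint_inner_right, adjoint_leftLeg_amplify_apply, ← hl, amplify_apply,
    mapH_tmulH, one_apply_eq_self]

theorem eq_zero_of_amplify_apply_eq_zero {A : Set (K →L[ℂ] K)}
    (hA : ∀ h, (∀ a ∈ A, a h = 0) → h = 0) {t : HTensor L K}
    (ht : ∀ a ∈ A, amplify L K a t = 0) : t = 0 := by
  refine eq_of_inner_tmulH fun l h => ?_
  have hlt : ((leftLeg l)†) t = 0 := hA _ fun a ha => by
    rw [← adjoint_leftLeg_amplify_apply, ht a ha, map_zero]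
  rw [← leftLeg_apply, ← ContinuousLinearMap.adjoint_inner_right, hlt, inner_zero_right,
    inner_zero_right]

theorem exists_inner_amplify_eq {ω : StrongDual ℂ (K →L[ℂ] K)} (hω : ω ∈ predual K) :
    ∃ u v, ∀ x, ω x = ⟪v, amplify ℓ²(ℕ, ℂ) K x u⟫_ℂ := by
  obtain ⟨ξ, η, hξ, hη, hω⟩ := hω
  let e : HilbertBasis ℕ ℂ ℓ²(ℕ, ℂ) := .ofRepr (.refl ℂ _)
  obtain ⟨u, hu⟩ := exists_adjoint_leftLeg_eq e hξ
  obtain ⟨v, hv⟩ := exists_adjoint_leftLeg_eq e hη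
  refine ⟨u, v, fun x => (hω x).unique ?_⟩
  simpa only [adjoint_leftLeg_amplify_apply, hu, hv]
    using (isIdentityResolution_leftLeg e).hasSum_inner v (amplify ℓ²(ℕ, ℂ) K x u)

theorem isClosed_sigmaWeak_centralizer (A : Set (K →L[ℂ] K)) :
    IsClosed[sigmaWeakTopology K] A.centralizer := by
  let _ := sigmaWeakTopology K
  have := t2Space_sigmaWeak (K := K)
  rw [show A.centralizer = ⋂ a ∈ A, {x | a * x = x * a} by ext; simp [Set.mem_centralizer_iff]]
  exact isClosed_biInter fun a _ =>
    isClosed_eq (IsNormalMap.id.const_mul a).continuous (IsNormalMap.id.mul_const a).continuous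

theorem sigmaWeakClosure_eq_centralizer_centralizer (A : NonUnitalStarSubalgebra ℂ (K →L[ℂ] K))
    (hA : ∀ h, (∀ a ∈ A, a h = 0) → h = 0) :
    sigmaWeakClosure A = (A : Set (K →L[ℂ] K)).centralizer.centralizer := by
  refine (sigmaWeakClosure_subset Set.subset_centralizer_centralizer
    (isClosed_sigmaWeak_centralizer _)).antisymm fun x hx => ?_
  refine (mem_sigmaWeakClosure_iff A.toSubmodule x).2 fun ω hω hωA => ?_
  obtain ⟨u, v, hωuv⟩ := exists_inner_amplify_eq hω
  have hxu := apply_mem_closure_of_mem_centralizer_centralizer (A.map (amplify ℓ²(ℕ, ℂ) K))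
    (fun t ht => eq_zero_of_amplify_apply_eq_zero hA fun a ha => ht _ ⟨a, ha, rfl⟩)
    (x := amplify ℓ²(ℕ, ℂ) K x) (amplify_mem_centralizer_centralizer hx) u
  have hclosed : IsClosed {t | ⟪v, t⟫_ℂ = 0} := isClosed_eq (by fun_prop) continuous_const
  refine (hωuv x).trans (closure_minimal ?_ hclosed hxu)
  rintro _ ⟨_, ⟨a, ha, rfl⟩, rfl⟩
  exact (hωuv a).symm.trans (hωA a ha)

end DoubleCommutant

section VectorSlice

variable {X K L : Type*} [NormedAddCommGroup X] [InnerProductSpace ℂ X]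
  [NormedAddCommGroup K] [InnerProductSpace ℂ K] [CompleteSpace K]
  [NormedAddCommGroup L] [InnerProductSpace ℂ L] [CompleteSpace L]

/-- The slice of `T` by the vector functional `⟪p, · q⟫`, with respect to a family of operators
`N x : K → L` depending linearly on `x`. For `N = rightLeg` this is `(ι ⊗ ω)(T)`, and for
`N = leftLeg` it is `(ω ⊗ ι)(T)`, where `ω x = ⟪p, x q⟫`. -/
def vectorSlice (N : X →L[ℂ] K →L[ℂ] L) (p q : X) (T : L →L[ℂ] L) : K →L[ℂ] K :=
  (N p)† ∘L T ∘L N q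

variable {N : X →L[ℂ] K →L[ℂ] L} {p q : X}

theorem star_vectorSlice (N : X →L[ℂ] K →L[ℂ] L) (p q : X) (T : L →L[ℂ] L) :
    star (vectorSlice N p q T) = vectorSlice N q p (star T) := by
  simp only [vectorSlice, ContinuousLinearMap.star_eq_adjoint, ContinuousLinearMap.adjoint_comp,
    ContinuousLinearMap.adjoint_adjoint, ContinuousLinearMap.comp_assoc]

theorem vectorSlice_mul {q' : X} {A : L →L[ℂ] L} {a : K →L[ℂ] K} (h : A ∘L N q = N q' ∘L a)
    (T : L →L[ℂ] L) : vectorSlice N p q (T * A) = vectorSlice N p q' T * a := by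
  simp only [vectorSlice, ContinuousLinearMap.mul_def, ContinuousLinearMap.comp_assoc, h]

theorem mul_vectorSlice {p' : X} {A : L →L[ℂ] L} {a : K →L[ℂ] K}
    (h : star A ∘L N p = N p' ∘L star a) (T : L →L[ℂ] L) :
    vectorSlice N p q (A * T) = a * vectorSlice N p' q T := by
  apply star_injective
  rw [star_mul, star_vectorSlice, star_vectorSlice, star_mul, vectorSlice_mul h]

theorem norm_vectorSlice_le (N : X →L[ℂ] K →L[ℂ] L) (p q : X) (T : L →L[ℂ] L) :
    ‖vectorSlice N p q T‖ ≤ ‖N‖ ^ 2 * ‖T‖ * (‖p‖ * ‖q‖) :=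
  calc ‖vectorSlice N p q T‖ ≤ ‖(N p)†‖ * (‖T‖ * ‖N q‖) :=
        (ContinuousLinearMap.opNorm_comp_le _ _).trans <| by
          gcongr; exact ContinuousLinearMap.opNorm_comp_le _ _
    _ ≤ (‖N‖ * ‖p‖) * (‖T‖ * (‖N‖ * ‖q‖)) := by
        rw [LinearIsometryEquiv.norm_map]
        gcongr <;> exact N.le_opNorm _
    _ = ‖N‖ ^ 2 * ‖T‖ * (‖p‖ * ‖q‖) := by ring

theorem vectorSlice_mem_of_tmulH {E F : Type*} [NormedAddCommGroup E] [InnerProductSpace ℂ E]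
    [NormedAddCommGroup F] [InnerProductSpace ℂ F] {N : HTensor E F →L[ℂ] K →L[ℂ] L}
    {T : L →L[ℂ] L} {C : Submodule ℂ (K →L[ℂ] K)} (hC : IsClosed (C : Set (K →L[ℂ] K)))
    (h : ∀ p p' q q', vectorSlice N (tmulH p p') (tmulH q q') T ∈ C) (P Q : HTensor E F) :
    vectorSlice N P Q T ∈ C := by
  have hQ : ∀ p p', vectorSlice N (tmulH p p') Q T ∈ C := fun p p' =>
    map_mem_of_tmulH
      (ContinuousLinearMap.compL ℂ K L K ((N (tmulH p p'))† ∘L T) ∘L N) hC (h p p') Q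
  let conjLinear : HTensor E F →L⋆[ℂ] K →L[ℂ] K :=
    ((ContinuousLinearMap.compL ℂ K L K).flip (T ∘L N Q)).comp
      ((ContinuousLinearMap.adjoint : (K →L[ℂ] L) ≃ₗᵢ⋆[ℂ] L →L[ℂ] K)
        |>.toContinuousLinearEquiv.toContinuousLinearMap.comp N)
  exact map_mem_of_tmulH conjLinear hC hQ P

theorem IsNormalMap.vectorSlice {J : Type*} [NormedAddCommGroup J] [InnerProductSpace ℂ J]
    {Φ : (J →L[ℂ] J) → L →L[ℂ] L} (hΦ : IsNormalMap Φ) (N : X →L[ℂ] K →L[ℂ] L) (p q : X) :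
    IsNormalMap fun x => vectorSlice N p q (Φ x) :=
  hΦ.comp_comp _ _

end VectorSlice

section VectorSliceTensor

variable {E F : Type*} [NormedAddCommGroup E] [InnerProductSpace ℂ E]
  [NormedAddCommGroup F] [InnerProductSpace ℂ F]
  (T : HTensor E F →L[ℂ] HTensor E F) (a : E →L[ℂ] E) (b : F →L[ℂ] F)

@[simp] theorem vectorSlice_rightLeg_mapH [CompleteSpace E] (p q : F) :
    vectorSlice rightLeg p q (mapH a b) = ⟪p, b q⟫_ℂ • a := by
  ext x
  simp [vectorSlice, adjoint_rightLeg_apply]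

@[simp] theorem vectorSlice_rightLeg_one [CompleteSpace E] (p q : F) :
    vectorSlice rightLeg p q (1 : HTensor E F →L[ℂ] HTensor E F) = ⟪p, q⟫_ℂ • 1 := by
  simpa using vectorSlice_rightLeg_mapH (1 : E →L[ℂ] E) (1 : F →L[ℂ] F) p q

@[simp] theorem vectorSlice_leftLeg_mapH [CompleteSpace F] (p q : E) :
    vectorSlice leftLeg p q (mapH a b) = ⟪p, a q⟫_ℂ • b := by
  ext y
  simp [vectorSlice, adjoint_leftLeg_apply]

theorem vectorSlice_rightLeg_mul_mapH [CompleteSpace E] (p q : F) :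
    vectorSlice rightLeg p q (T * mapH a b) = vectorSlice rightLeg p (b q) T * a :=
  vectorSlice_mul (mapH_comp_rightLeg a b q) T

theorem vectorSlice_leftLeg_mul_mapH [CompleteSpace F] (p q : E) :
    vectorSlice leftLeg p q (T * mapH a b) = vectorSlice leftLeg p (a q) T * b :=
  vectorSlice_mul (mapH_comp_leftLeg a b q) T

variable [CompleteSpace E] [CompleteSpace F]

theorem vectorSlice_rightLeg_mapH_mul (p q : F) :
    vectorSlice rightLeg p q (mapH a b * T) = a * vectorSlice rightLeg (star b p) q T :=
  mul_vectorSlice (by rw [star_mapH, mapH_comp_rightLeg]) T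

theorem vectorSlice_leftLeg_mapH_mul (p q : E) :
    vectorSlice leftLeg p q (mapH a b * T) = b * vectorSlice leftLeg (star a p) q T :=
  mul_vectorSlice (by rw [star_mapH, mapH_comp_leftLeg]) T

end VectorSliceTensor

section MidLeg

variable {H : Type*} [NormedAddCommGroup H] [InnerProductSpace ℂ H]

/-- `x ⊗ z ↦ (y ↦ x ⊗ (y ⊗ z))`. -/
def midLeg : HTensor H H →L[ℂ] H →L[ℂ] HTensor H (HTensor H H) :=
  (ContinuousLinearMap.compL ℂ H (HTensor (HTensor H H) H) (HTensor H (HTensor H H))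
    (leg23 flipH ∘L (assocH H H H : HTensor (HTensor H H) H →L[ℂ] HTensor H (HTensor H H)))) ∘L
      leftLeg

@[simp] theorem midLeg_tmulH_apply (x y z : H) :
    midLeg (tmulH x z) y = tmulH x (tmulH y z) := by
  simp [midLeg]

theorem leg13_comp_midLeg (T : HTensor H H →L[ℂ] HTensor H H) (t : HTensor H H) :
    leg13 T ∘L midLeg t = midLeg (T t) := by
  ext y
  have flip_flip : ∀ s : HTensor H (HTensor H H), leg23 flipH (leg23 flipH s) = s :=
    DFunLike.congr_fun leg23_flipH_mul_leg23_flipH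
  simp [midLeg, leg13, leg12, flip_flip]

end MidLeg

section VectorSliceLegs

variable {H : Type*} [NormedAddCommGroup H] [InnerProductSpace ℂ H] [CompleteSpace H]

theorem commute_leg13_leg23_mapH_one (T : HTensor H H →L[ℂ] HTensor H H) (a : H →L[ℂ] H) :
    Commute (leg13 T) (leg23 (mapH a 1)) :=
  (IsNormalMap.id.leg13.mul_const _).ext_mapH (IsNormalMap.id.leg13.const_mul _)
    (fun _ _ => by simp [mapH_mul]) T

theorem commute_leg12_leg23_one_mapH (T : HTensor H H →L[ℂ] HTensor H H) (b : H →L[ℂ] H) :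
    Commute (leg12 T) (leg23 (mapH 1 b)) :=
  (IsNormalMap.id.leg12.mul_const _).ext_mapH (IsNormalMap.id.leg12.const_mul _)
    (fun _ _ => by simp [mapH_mul]) T

theorem vectorSlice_mul_leg23 (P Q : HTensor H H) (T : _ →L[ℂ] HTensor H (HTensor H H))
    (A : HTensor H H →L[ℂ] HTensor H H) :
    vectorSlice rightLeg P Q (T * leg23 A) = vectorSlice rightLeg P (A Q) T :=
  vectorSlice_rightLeg_mul_mapH T 1 A P Q

theorem vectorSlice_leg23_mul (P Q : HTensor H H) (T : _ →L[ℂ] HTensor H (HTensor H H))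
    (A : HTensor H H →L[ℂ] HTensor H H) :
    vectorSlice rightLeg P Q (leg23 A * T) = vectorSlice rightLeg (star A P) Q T :=
  vectorSlice_rightLeg_mapH_mul T 1 A P Q

theorem vectorSlice_leg12_mul_leg13 (p p' q q' : H) (T T' : HTensor H H →L[ℂ] HTensor H H) :
    vectorSlice rightLeg (tmulH p p') (tmulH q q') (leg12 T * leg13 T') =
      vectorSlice rightLeg p q T * vectorSlice rightLeg p' q' T' := by
  refine (((IsNormalMap.id.leg12).mul_const _).vectorSlice _ _ _).ext_mapH
    ((IsNormalMap.id.vectorSlice _ _ _).mul_const _) (fun a b => ?_) T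
  refine (((IsNormalMap.id.leg13).const_mul _).vectorSlice _ _ _).ext_mapH
    ((IsNormalMap.id.vectorSlice _ _ _).const_mul _) (fun c d => ?_) T'
  simp [mapH_mul, smul_smul, mul_comm]

theorem vectorSlice_leg13_mul_mapH_mul_leg12 (p₁ p₂ q₁ q₂ : H) (a b : H →L[ℂ] H)
    (T T' : HTensor H H →L[ℂ] HTensor H H) :
    vectorSlice rightLeg (tmulH p₁ p₂) (tmulH q₁ q₂) (leg13 T * leg23 (mapH a b) * leg12 T') =
      vectorSlice rightLeg p₂ (b q₂) T * vectorSlice rightLeg (star a p₁) q₁ T' := by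
  refine ((((IsNormalMap.id.leg13).mul_const _).mul_const _).vectorSlice _ _ _).ext_mapH
    ((IsNormalMap.id.vectorSlice _ _ _).mul_const _) (fun c d => ?_) T
  refine (((IsNormalMap.id.leg12).const_mul _).vectorSlice _ _ _).ext_mapH
    ((IsNormalMap.id.vectorSlice _ _ _).const_mul _) (fun c' d' => ?_) T'
  simp [mapH_mul, smul_smul, ContinuousLinearMap.star_eq_adjoint,
    ContinuousLinearMap.adjoint_inner_left]

theorem vectorSlice_leftLeg_leg12 (p q : H) (T : HTensor H H →L[ℂ] HTensor H H) :
    vectorSlice leftLeg p q (leg12 T) = mapH (vectorSlice leftLeg p q T) 1 := by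
  refine (IsNormalMap.id.leg12.vectorSlice _ _ _).ext_mapH
    (IsNormalMap.id.vectorSlice _ _ _).mapH_one_right (fun a b => ?_) T
  simp [smul_mapH]

@[simp] theorem vectorSlice_midLeg_mapH (p p' q q' : H) (a b c : H →L[ℂ] H) :
    vectorSlice midLeg (tmulH p p') (tmulH q q') (mapH a (mapH b c)) =
      (⟪p, a q⟫_ℂ * ⟪p', c q'⟫_ℂ) • b := by
  ext y
  refine ext_inner_left ℂ fun x => ?_
  simp [vectorSlice, ContinuousLinearMap.adjoint_inner_right, inner_smul_right]
  ring

theorem vectorSlice_midLeg_leg12_mul_leg23 (p p' q q' : H)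
    (T T' : HTensor H H →L[ℂ] HTensor H H) :
    vectorSlice midLeg (tmulH p p') (tmulH q q') (leg12 T * leg23 T') =
      vectorSlice leftLeg p q T * vectorSlice rightLeg p' q' T' := by
  refine (((IsNormalMap.id.leg12).mul_const _).vectorSlice _ _ _).ext_mapH
    ((IsNormalMap.id.vectorSlice _ _ _).mul_const _) (fun a b => ?_) T
  refine (((IsNormalMap.id.leg23).const_mul _).vectorSlice _ _ _).ext_mapH
    ((IsNormalMap.id.vectorSlice _ _ _).const_mul _) (fun c d => ?_) T'
  simp [mapH_mul, smul_smul, mul_comm]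

end VectorSliceLegs

section SliceAlong

variable {H K : Type*} [NormedAddCommGroup H] [InnerProductSpace ℂ H] [CompleteSpace H]
  [NormedAddCommGroup K] [InnerProductSpace ℂ K] [CompleteSpace K]

theorem sliceAlong_vectorFunctional (L : H →L[ℂ] H →L[ℂ] K) (T : K →L[ℂ] K) (p q : H) :
    sliceAlong L T (vectorFunctional p q) = vectorSlice L.flip p q T := by
  ext x
  refine ext_inner_left ℂ fun y => ?_
  simp [inner_sliceAlong, vectorSlice, ContinuousLinearMap.adjoint_inner_right]

theorem sliceAlong_mem {L : H →L[ℂ] H →L[ℂ] K} {T : K →L[ℂ] K} {C : Submodule ℂ (H →L[ℂ] H)}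
    (hC : IsClosed (C : Set (H →L[ℂ] H))) (h : ∀ p q, vectorSlice L.flip p q T ∈ C)
    {ω : StrongDual ℂ (H →L[ℂ] H)} (hω : ω ∈ predual H) : sliceAlong L T ω ∈ C := by
  obtain ⟨ξ, η, hξ, hη, hω⟩ := hω
  have hs : Summable fun n => vectorSlice L.flip (η n) (ξ n) T :=
    .of_norm_bounded ((summable_norm_mul_norm_of_sq hξ hη).mul_left _)
      fun n => norm_vectorSlice_le _ _ _ _
  have hslice : sliceAlong L T ω = ∑' n, vectorSlice L.flip (η n) (ξ n) T := by
    ext x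
    refine ext_inner_left ℂ fun y => ?_
    rw [inner_sliceAlong]
    refine (hω _).unique ?_
    have hx := (innerSL ℂ y).hasSum ((ContinuousLinearMap.apply ℂ H x).hasSum hs.hasSum)
    simpa [vectorSlice, ContinuousLinearMap.adjoint_inner_right] using hx
  rw [hslice]
  exact hC.mem_of_tendsto hs.hasSum (.of_forall fun s => C.sum_mem fun n _ => h _ _)

/-- `ω ↦ sliceAlong L T ω` as a linear map. -/
def sliceMap (L : H →L[ℂ] H →L[ℂ] K) (T : K →L[ℂ] K) :
    StrongDual ℂ (H →L[ℂ] H) →ₗ[ℂ] H →L[ℂ] H where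
  toFun := sliceAlong L T
  map_add' ω ω' := by
    ext x
    refine ext_inner_left ℂ fun y => ?_
    simp [inner_sliceAlong, inner_add_right]
  map_smul' c ω := by
    ext x
    refine ext_inner_left ℂ fun y => ?_
    simp [inner_sliceAlong, inner_smul_right]

/-- The slices of `T` by the functionals in the predual, as a subspace. Both `S` and `Ŝ` are of this
form. -/
def sliceSubmodule (L : H →L[ℂ] H →L[ℂ] K) (T : K →L[ℂ] K) : Submodule ℂ (H →L[ℂ] H) :=
  (predualSubmodule H).map (sliceMap L T)

theorem star_mem_sliceSubmodule_star {L : H →L[ℂ] H →L[ℂ] K} {T : K →L[ℂ] K} {x : H →L[ℂ] H}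
    (hx : x ∈ sliceSubmodule L T) : star x ∈ sliceSubmodule L (star T) := by
  obtain ⟨ω, ⟨ξ, η, hξ, hη, hω⟩, rfl⟩ := hx
  obtain ⟨ω', hω', hω'x⟩ := exists_mem_predual hη hξ
  refine ⟨ω', hω', ?_⟩
  ext x
  refine ext_inner_left ℂ fun y => ?_
  change ⟪y, sliceAlong L (star T) ω' x⟫_ℂ = ⟪y, ((sliceAlong L T ω)†) x⟫_ℂ
  rw [inner_sliceAlong, ContinuousLinearMap.adjoint_inner_right, ← inner_conj_symm,
    inner_sliceAlong]
  refine (hω'x _).unique ?_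
  have hconj := Complex.hasSum_conj'.2 (hω ((L x)† ∘L T ∘L L y))
  simpa [ContinuousLinearMap.star_eq_adjoint, ContinuousLinearMap.adjoint_inner_right,
    ContinuousLinearMap.adjoint_inner_left] using hconj

theorem star_mem_algS_star {W : HTensor H H →L[ℂ] HTensor H H} {s : H →L[ℂ] H} (hs : s ∈ algS W) :
    star s ∈ algS (star W) :=
  star_mem_sliceSubmodule_star (L := leftLeg) hs

theorem star_mem_algShat_star {W : HTensor H H →L[ℂ] HTensor H H} {t : H →L[ℂ] H}
    (ht : t ∈ algShat W) : star t ∈ algShat (star W) :=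
  star_mem_sliceSubmodule_star (L := rightLeg) ht

theorem vectorSlice_mem_algS (W : HTensor H H →L[ℂ] HTensor H H) (p q : H) :
    vectorSlice rightLeg p q W ∈ algS W :=
  ⟨_, vectorFunctional_mem_predual p q, sliceAlong_vectorFunctional _ _ p q⟩

theorem vectorSlice_mem_algShat (W : HTensor H H →L[ℂ] HTensor H H) (p q : H) :
    vectorSlice leftLeg p q W ∈ algShat W :=
  ⟨_, vectorFunctional_mem_predual p q,
    (sliceAlong_vectorFunctional _ _ p q).trans (by rw [flip_rightLeg])⟩

theorem algS_subset {W : HTensor H H →L[ℂ] HTensor H H} {C : Submodule ℂ (H →L[ℂ] H)}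
    (hC : IsClosed (C : Set (H →L[ℂ] H))) (h : ∀ p q, vectorSlice rightLeg p q W ∈ C) :
    algS W ⊆ C := by
  rintro _ ⟨ω, hω, rfl⟩
  exact sliceAlong_mem hC h hω

theorem algShat_subset {W : HTensor H H →L[ℂ] HTensor H H} {C : Submodule ℂ (H →L[ℂ] H)}
    (hC : IsClosed (C : Set (H →L[ℂ] H))) (h : ∀ p q, vectorSlice leftLeg p q W ∈ C) :
    algShat W ⊆ C := by
  rintro _ ⟨ω, hω, rfl⟩
  exact sliceAlong_mem (L := rightLeg) hC (flip_rightLeg (E := H) (F := H) ▸ h) hω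

end SliceAlong

section MultiplicativeUnitary

variable {H : Type*} [NormedAddCommGroup H] [InnerProductSpace ℂ H]
  {W : HTensor H H →L[ℂ] HTensor H H} {C : Submodule ℂ (H →L[ℂ] H)}

theorem vectorSlice_leg12_mem_iff [CompleteSpace H]
    (hC : IsClosed (C : Set (H →L[ℂ] H)))
    {T : HTensor H H →L[ℂ] HTensor H H} :
    (∀ P Q, vectorSlice rightLeg P Q (leg12 T) ∈ C) ↔ ∀ p q, vectorSlice rightLeg p q T ∈ C := by
  have hT : ∀ p p' q q', vectorSlice rightLeg (tmulH p p') (tmulH q q') (leg12 T) =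
      ⟪p', q'⟫_ℂ • vectorSlice rightLeg p q T := fun p p' q q' => by
    simpa only [leg13_one, mul_one, vectorSlice_rightLeg_one, mul_smul_comm] using
      vectorSlice_leg12_mul_leg13 p p' q q' T 1
  refine ⟨fun h p q => ?_, fun h => vectorSlice_mem_of_tmulH hC fun p p' q q' => ?_⟩
  · rcases eq_or_ne q 0 with rfl | hq
    · simp [vectorSlice]
    · exact (C.smul_mem_iff (inner_self_ne_zero.2 hq)).1 (hT p q q q ▸ h _ _)
  · rw [hT]
    exact C.smul_mem _ (h p q)

namespace IsMultiplicativeUnitary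

variable (hW : IsMultiplicativeUnitary W)
include hW

theorem star_mul_self : star W * W = 1 := Unitary.star_mul_self_of_mem hW.mem_unitary

theorem mul_star_self : W * star W = 1 := Unitary.mul_star_self_of_mem hW.mem_unitary

theorem leg12_mul_leg13 : leg12 W * leg13 W = leg23 W * leg12 W * leg23 (star W) := by
  rw [← hW.pentagon, mul_assoc _ (leg23 W), ← leg23_mul, hW.mul_star_self, leg23_one, mul_one]

theorem leg13_mul_leg23_mul_leg12_star :
    leg13 W * leg23 W * leg12 (star W) = leg12 (star W) * leg23 W :=
  calc leg13 W * leg23 W * leg12 (star W)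
      = leg12 (star W) * (leg12 W * leg13 W * leg23 W) * leg12 (star W) := by
        simp only [← mul_assoc, ← leg12_mul, hW.star_mul_self, leg12_one, one_mul]
    _ = leg12 (star W) * leg23 W := by
        rw [hW.pentagon, mul_assoc, mul_assoc, ← leg12_mul, hW.mul_star_self, leg12_one, mul_one]

theorem leg23_mul_leg12_star :
    leg23 W * leg12 (star W) = leg13 (star W) * (leg12 (star W) * leg23 W) := by
  rw [← hW.leg13_mul_leg23_mul_leg12_star, ← mul_assoc, ← mul_assoc, ← leg13_mul,
    hW.star_mul_self, leg13_one, one_mul]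

variable [CompleteSpace H]

theorem vectorSlice_mul_vectorSlice_mem (hC : IsClosed (C : Set (H →L[ℂ] H)))
    (h : ∀ p q, vectorSlice rightLeg p q W ∈ C) (p q p' q' : H) :
    vectorSlice rightLeg p q W * vectorSlice rightLeg p' q' W ∈ C := by
  rw [← vectorSlice_leg12_mul_leg13, hW.leg12_mul_leg13, vectorSlice_mul_leg23,
    vectorSlice_leg23_mul]
  exact (vectorSlice_leg12_mem_iff hC).2 h _ _

theorem vectorSlice_star_mem (hC : IsClosed[sigmaWeakTopology H] (C : Set (H →L[ℂ] H)))
    (h : ∀ p q p' q',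
      vectorSlice rightLeg p q W * vectorSlice rightLeg p' q' (star W) ∈ C) (p q : H) :
    vectorSlice rightLeg p q (star W) ∈ C := by
  have hC' := isClosed_of_isClosed_sigmaWeak hC
  have hX : ∀ X P Q,
      vectorSlice rightLeg P Q (leg13 W * leg23 X * leg12 (star W)) ∈ C := fun X =>
    vectorSlice_mem_of_tmulH hC' fun p p' q q' =>
      (((IsNormalMap.id.leg23.const_mul _).mul_const _).vectorSlice _ _ _).mem_of_mapH hC
        (fun a b => vectorSlice_leg13_mul_mapH_mul_leg12 p p' q q' a b W (star W) ▸ h _ _ _ _) X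
  refine (vectorSlice_leg12_mem_iff hC').1 (fun P Q => ?_) p q
  have hQ : W (star W Q) = Q := DFunLike.congr_fun hW.mul_star_self Q
  have hPQ := hX W P (star W Q)
  rwa [hW.leg13_mul_leg23_mul_leg12_star, vectorSlice_mul_leg23, hQ] at hPQ

end IsMultiplicativeUnitary

end MultiplicativeUnitary

namespace AntiunitaryInvolution

section Prod

variable {E F : Type*} [NormedAddCommGroup E] [InnerProductSpace ℂ E]
  [NormedAddCommGroup F] [InnerProductSpace ℂ F]
  (J : AntiunitaryInvolution E) (K : AntiunitaryInvolution F)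

@[simp] theorem toCLM_apply (x : E) : J.toCLM x = J.toFun x := rfl

theorem inner_tensorProductMap (s t : E ⊗[ℂ] F) :
    ⟪TensorProduct.map J.toFun K.toFun s, TensorProduct.map J.toFun K.toFun t⟫_ℂ = ⟪t, s⟫_ℂ := by
  induction s with
  | zero => simp
  | add s s' hs hs' => simp [inner_add_left, inner_add_right, hs, hs']
  | tmul x y =>
    induction t with
    | zero => simp
    | add t t' ht ht' => rw [map_add, inner_add_left, inner_add_right, ht, ht']
    | tmul x' y' => simp [inner_map_map]

/-- The operator underlying `AntiunitaryInvolution.prod`. -/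
def tensorCLM : HTensor E F →L⋆[ℂ] HTensor E F :=
  extendH ((TensorProduct.map J.toFun K.toFun).mkContinuous 1 fun t => by
    rw [one_mul, @norm_eq_sqrt_re_inner ℂ, @norm_eq_sqrt_re_inner ℂ _ _ _ _ t,
      inner_tensorProductMap])

@[simp] theorem tensorCLM_tmulH (x : E) (y : F) :
    J.tensorCLM K (tmulH x y) = tmulH (J.toFun x) (K.toFun y) := by
  simp [tensorCLM, tmulH]

theorem tensorCLM_tensorCLM (t : HTensor E F) : J.tensorCLM K (J.tensorCLM K t) = t :=
  have h : (J.tensorCLM K).comp (J.tensorCLM K) = .id ℂ _ :=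
    ext_tmulH fun x y => by simp [involutive]
  DFunLike.congr_fun h t

theorem inner_tensorCLM_tensorCLM (s t : HTensor E F) :
    ⟪J.tensorCLM K s, J.tensorCLM K t⟫_ℂ = ⟪t, s⟫_ℂ := by
  induction s, t using DenseRange.induction_on₂ (denseRange_emb (E := E) (F := F)) with
  | hp => exact isClosed_eq (by fun_prop) (by fun_prop)
  | h a b =>
    rw [tensorCLM, extendH_emb, extendH_emb, LinearIsometry.inner_map_map,
      LinearIsometry.inner_map_map]
    exact inner_tensorProductMap J K a b

/-- The tensor product `J ⊗ K` as an anti-unitary involution. In contrast to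
`AntiunitaryInvolution.tensor`, it allows two different spaces, so that it can be iterated. -/
def prod : AntiunitaryInvolution (HTensor E F) where
  toFun := (J.tensorCLM K).toLinearMap
  selfAdjoint s t := by
    have h := J.inner_tensorCLM_tensorCLM K s (J.tensorCLM K t)
    rwa [tensorCLM_tensorCLM] at h
  involutive := J.tensorCLM_tensorCLM K

@[simp] theorem prod_tmulH (x : E) (y : F) :
    (J.prod K).toFun (tmulH x y) = tmulH (J.toFun x) (K.toFun y) :=
  J.tensorCLM_tmulH K x y

end Prod

section Conjugate

variable {H : Type*} [NormedAddCommGroup H] [InnerProductSpace ℂ H]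
  (J K L : AntiunitaryInvolution H)

theorem toCLM_prod : (J.prod K).toCLM = J.tensor K :=
  ext_tmulH fun x y => by simp

@[simp] theorem conjugate_apply (a : H →L[ℂ] H) (x : H) :
    J.conjugate a x = J.toFun (a (J.toFun x)) := rfl

theorem conjugate_mul (a b : H →L[ℂ] H) : J.conjugate (a * b) = J.conjugate a * J.conjugate b := by
  ext x; simp [involutive]

@[simp] theorem conjugate_one : J.conjugate 1 = 1 := by
  ext x; simp [involutive]

@[simp] theorem conjugate_conjugate (a : H →L[ℂ] H) : J.conjugate (J.conjugate a) = a := by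
  ext x; simp [involutive]

theorem conjugate_prod_mapH (a b : H →L[ℂ] H) :
    (J.prod K).conjugate (mapH a b) = mapH (J.conjugate a) (K.conjugate b) :=
  ext_tmulH fun x y => by simp

theorem conjugate_leg23 (T : HTensor H H →L[ℂ] HTensor H H) :
    (J.prod (K.prod L)).conjugate (leg23 T) = leg23 ((K.prod L).conjugate T) :=
  ext_tmulH fun x t => by simp [involutive]

theorem prod_assocH (t : HTensor H H) (z : H) :
    (J.prod (K.prod L)).toFun (assocH H H H (tmulH t z)) =
      assocH H H H (tmulH ((J.prod K).toFun t) (L.toFun z)) := by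
  have h : (J.prod (K.prod L)).toCLM.comp ((assocH H H H : HTensor (HTensor H H) H →L[ℂ]
      HTensor H (HTensor H H)).comp (rightLeg z)) =
      ((assocH H H H : HTensor (HTensor H H) H →L[ℂ] HTensor H (HTensor H H)).comp
        (rightLeg (L.toFun z))).comp (J.prod K).toCLM :=
    ext_tmulH fun x y => by simp
  exact DFunLike.congr_fun h t

theorem prod_midLeg (t : HTensor H H) (y : H) :
    (J.prod (K.prod L)).toFun (midLeg t y) = midLeg ((J.prod L).toFun t) (K.toFun y) := by
  have h : (J.prod (K.prod L)).toCLM.comp (midLeg.flip y) =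
      (midLeg.flip (K.toFun y)).comp (J.prod L).toCLM :=
    ext_tmulH fun x z => by simp
  exact DFunLike.congr_fun h t

theorem conjugate_leg12 (T : HTensor H H →L[ℂ] HTensor H H) :
    (J.prod (K.prod L)).conjugate (leg12 T) = leg12 ((J.prod K).conjugate T) := by
  refine ext_tmulH₃ fun x y z => ?_
  rw [← assocH_tmulH]
  simp [leg12, prod_assocH, involutive]

theorem conjugate_leg13 (T : HTensor H H →L[ℂ] HTensor H H) :
    (J.prod (K.prod L)).conjugate (leg13 T) = leg13 ((J.prod L).conjugate T) := by
  have leg13_midLeg : ∀ (S : HTensor H H →L[ℂ] HTensor H H) t y,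
      leg13 S (midLeg t y) = midLeg (S t) y := fun S t => DFunLike.congr_fun (leg13_comp_midLeg S t)
  refine ext_tmulH₃ fun x y z => ?_
  rw [← midLeg_tmulH_apply, conjugate_apply, prod_midLeg, leg13_midLeg, prod_midLeg, leg13_midLeg,
    conjugate_apply, involutive]

variable [CompleteSpace H]

theorem conjugate_vectorSlice_leftLeg (p q : H) (T : HTensor H H →L[ℂ] HTensor H H) :
    K.conjugate (vectorSlice leftLeg p q T) =
      vectorSlice leftLeg (J.toFun p) (J.toFun q) ((J.prod K).conjugate T) := by
  ext x
  refine ext_inner_right ℂ fun y => ?_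
  simp only [conjugate_apply, vectorSlice, ContinuousLinearMap.comp_apply, leftLeg_apply,
    prod_tmulH, selfAdjoint, ContinuousLinearMap.adjoint_inner_left,
    ContinuousLinearMap.adjoint_inner_right, involutive]

/-- The composite `K J` of two antilinear maps is linear, so this is a two-sided multiplication. -/
theorem isNormalMap_conjugate_conjugate : IsNormalMap fun x => K.conjugate (J.conjugate x) :=
  IsNormalMap.id.comp_comp (K.toCLM.comp J.toCLM) (J.toCLM.comp K.toCLM)

end Conjugate

end AntiunitaryInvolution

section Commute

variable {E F : Type*} [NormedAddCommGroup E] [InnerProductSpace ℂ E] [CompleteSpace E]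
  [NormedAddCommGroup F] [InnerProductSpace ℂ F]

theorem ext_vectorSlice_rightLeg {S T : HTensor E F →L[ℂ] HTensor E F}
    (h : ∀ p q, vectorSlice rightLeg p q S = vectorSlice rightLeg p q T) : S = T :=
  ext_tmulH fun x q => eq_of_inner_tmulH fun y p => by
    simpa [vectorSlice, ContinuousLinearMap.adjoint_inner_right] using
      congrArg (⟪y, · x⟫_ℂ) (h p q)

theorem commute_mapH_one [CompleteSpace F] {T : HTensor E F →L[ℂ] HTensor E F} {a : E →L[ℂ] E}
    (h : ∀ p q, Commute (vectorSlice rightLeg p q T) a) : Commute T (mapH a 1) :=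
  ext_vectorSlice_rightLeg fun p q => by
    rw [vectorSlice_rightLeg_mul_mapH, vectorSlice_rightLeg_mapH_mul, star_one]
    exact h p q

end Commute

section Regularity

variable {H : Type*} [NormedAddCommGroup H] [InnerProductSpace ℂ H]
  {W V : HTensor H H →L[ℂ] HTensor H H}

theorem leg23_mul_leg12_mapH_mul_mul_leg13 {A : HTensor H H →L[ℂ] HTensor H H}
    {n : H →L[ℂ] H} (hV : leg23 W * leg12 V * leg13 A = leg12 V * leg23 W)
    (hn : Commute W (mapH n 1)) :
    leg23 W * leg12 (mapH 1 n * V) * leg13 A = leg12 (mapH 1 n * V) * leg23 W :=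
  calc leg23 W * leg12 (mapH 1 n * V) * leg13 A
      = leg23 (W * mapH n 1) * leg12 V * leg13 A := by
        simp only [leg12_mul, leg23_mul, leg12_mapH, leg23_mapH, mul_assoc]
    _ = leg12 (mapH 1 n) * (leg23 W * leg12 V * leg13 A) := by
        rw [hn.eq]
        simp only [leg23_mul, leg12_mapH, leg23_mapH, mul_assoc]
    _ = leg12 (mapH 1 n * V) * leg23 W := by
        rw [hV, leg12_mul, mul_assoc]

variable [CompleteSpace H] {C : Submodule ℂ (HTensor H H →L[ℂ] HTensor H H)}

theorem IsMultiplicativeUnitary.mul_mapH_vectorSlice_mem (hW : IsMultiplicativeUnitary W)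
    (hV : leg23 W * leg12 V * leg13 (star W) = leg12 V * leg23 W)
    (hC : IsClosed[sigmaWeakTopology (HTensor H H)]
      (C : Set (HTensor H H →L[ℂ] HTensor H H)))
    (h : ∀ x b, mapH x 1 * W * mapH 1 b ∈ C) (p q : H) (c : H →L[ℂ] H) :
    W * mapH (vectorSlice leftLeg p q V) c ∈ C := by
  let Ψ : (HTensor H H →L[ℂ] HTensor H H) → HTensor H H →L[ℂ] HTensor H H := fun X =>
    vectorSlice leftLeg p q (leg23 W * leg12 V * leg13 (star W * X)) * mapH 1 c
  have hΨ : IsNormalMap Ψ :=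
    (((IsNormalMap.id.const_mul _).leg13.const_mul _).vectorSlice _ _ _).mul_const _
  have leftLeg_leg23 : ∀ r, vectorSlice leftLeg p r (leg12 V * leg23 W) =
      mapH (vectorSlice leftLeg p r V) 1 * W := fun r => by
    rw [← vectorSlice_leftLeg_leg12]
    exact vectorSlice_leftLeg_mul_mapH _ 1 W p r
  have hmapH : ∀ d b, Ψ (mapH d b) ∈ C := fun d b => by
    have hΨdb : Ψ (mapH d b) = mapH (vectorSlice leftLeg p (d q) V) 1 * W * mapH 1 (b * c) := by
      simp only [Ψ, leg13_mul, leg13_mapH]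
      rw [← mul_assoc, hV, vectorSlice_leftLeg_mul_mapH, leftLeg_leg23, mul_assoc _ (mapH 1 b),
        mapH_mul, one_mul]
    exact hΨdb ▸ h _ _
  have hΨW : Ψ W = W * mapH (vectorSlice leftLeg p q V) c := by
    have hleg : vectorSlice leftLeg p q (leg23 W * leg12 V) =
        W * vectorSlice leftLeg p q (leg12 V) := by
      rw [leg23, ← ContinuousLinearMap.one_def, vectorSlice_leftLeg_mapH_mul, star_one]; rfl
    simp only [Ψ, hW.star_mul_self, leg13_one, mul_one, hleg, vectorSlice_leftLeg_leg12]
    rw [mul_assoc, mapH_mul, mul_one, one_mul]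
  exact hΨW ▸ hΨ.mem_of_mapH hC hmapH W

end Regularity

namespace IsQuantumGroupFrame

variable {H : Type*} [NormedAddCommGroup H] [InnerProductSpace ℂ H] [CompleteSpace H]
  {W : HTensor H H →L[ℂ] HTensor H H} {J Jhat : AntiunitaryInvolution H}
  (hW : IsQuantumGroupFrame W J Jhat)
include hW

theorem star_eq_conjugate : star W = (Jhat.prod J).conjugate W := by
  rw [AntiunitaryInvolution.conjugate, Jhat.toCLM_prod]
  exact hW.star_eq

theorem leg23_mul_leg12_conjugate_mul_leg13_star :
    leg23 W * leg12 ((Jhat.prod Jhat).conjugate W) * leg13 (star W) =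
      leg12 ((Jhat.prod Jhat).conjugate W) * leg23 W := by
  have hpentagon := congrArg (Jhat.prod (Jhat.prod J)).conjugate
    hW.isMultiplicativeUnitary.pentagon
  simp only [AntiunitaryInvolution.conjugate_mul, AntiunitaryInvolution.conjugate_leg12,
    AntiunitaryInvolution.conjugate_leg13, AntiunitaryInvolution.conjugate_leg23,
    ← hW.star_eq_conjugate] at hpentagon
  calc leg23 W * leg12 ((Jhat.prod Jhat).conjugate W) * leg13 (star W)
      = leg23 W * (leg12 ((Jhat.prod Jhat).conjugate W) * leg13 (star W) * leg23 (star W)) *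
          leg23 W := by
        simp only [mul_assoc, ← leg23_mul, hW.isMultiplicativeUnitary.star_mul_self, leg23_one,
          mul_one]
    _ = leg12 ((Jhat.prod Jhat).conjugate W) * leg23 W := by
        rw [hpentagon, ← mul_assoc, ← leg23_mul, hW.isMultiplicativeUnitary.mul_star_self,
          leg23_one, one_mul]

theorem commute_mapH_conjugate_conjugate {m : H →L[ℂ] H} (hm : m ∈ algM W) :
    Commute W (mapH (Jhat.conjugate (J.conjugate m)) 1) := by
  have hcomm : Commute W (mapH (star (J.conjugate m)) 1) := commute_mapH_one fun p q =>
    VonNeumannAlgebra.mem_commutant_iff.1 (star_mem (hW.conj_M m hm)) _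
      ((isLeast_generatedVN _).1 (vectorSlice_mem_algS W p q))
  have hstar := hcomm.star_star.eq
  rw [star_mapH, star_star, star_one, hW.star_eq_conjugate] at hstar
  simpa only [Commute, SemiconjBy, AntiunitaryInvolution.conjugate_mul,
    AntiunitaryInvolution.conjugate_conjugate, AntiunitaryInvolution.conjugate_prod_mapH,
    AntiunitaryInvolution.conjugate_one] using congrArg (Jhat.prod J).conjugate hstar

theorem vectorSlice_conjugate (p q : H) :
    vectorSlice leftLeg p q ((Jhat.prod Jhat).conjugate W) =
      Jhat.conjugate (J.conjugate (vectorSlice leftLeg p q (star W))) := by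
  rw [Jhat.conjugate_vectorSlice_leftLeg, Jhat.conjugate_vectorSlice_leftLeg,
    hW.star_eq_conjugate]
  simp only [AntiunitaryInvolution.conjugate_conjugate, AntiunitaryInvolution.involutive]

variable {C : Submodule ℂ (HTensor H H →L[ℂ] HTensor H H)}

theorem mul_mapH_conjugate_mem
    (hC : IsClosed[sigmaWeakTopology (HTensor H H)] (C : Set (HTensor H H →L[ℂ] HTensor H H)))
    (h : ∀ x b, mapH x 1 * W * mapH 1 b ∈ C) {m : H →L[ℂ] H} (hm : m ∈ algM W) (p q : H)
    (c : H →L[ℂ] H) :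
    W * mapH (Jhat.conjugate (J.conjugate (m * vectorSlice leftLeg p q (star W)))) c ∈ C := by
  have hV := leg23_mul_leg12_mapH_mul_mul_leg13 hW.leg23_mul_leg12_conjugate_mul_leg13_star
    (hW.commute_mapH_conjugate_conjugate hm)
  have hmem := hW.isMultiplicativeUnitary.mul_mapH_vectorSlice_mem hV hC h p q c
  rwa [vectorSlice_leftLeg_mapH_mul, star_one, one_apply_eq_self,
    hW.vectorSlice_conjugate, ← AntiunitaryInvolution.conjugate_mul,
    ← AntiunitaryInvolution.conjugate_mul] at hmem

theorem mul_mapH_mem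
    (hC : IsClosed[sigmaWeakTopology (HTensor H H)] (C : Set (HTensor H H →L[ℂ] HTensor H H)))
    (h : ∀ x b, mapH x 1 * W * mapH 1 b ∈ C) (x c : H →L[ℂ] H) : W * mapH x c ∈ C := by
  let Φ : (H →L[ℂ] H) → HTensor H H →L[ℂ] HTensor H H := fun y =>
    W * mapH (Jhat.conjugate (J.conjugate y)) 1 * mapH 1 c
  have hΦ : IsNormalMap Φ :=
    ((AntiunitaryInvolution.isNormalMap_conjugate_conjugate J Jhat).mapH_one_right.const_mul
      W).mul_const _
  have hΦ_eq : ∀ y, Φ y = W * mapH (Jhat.conjugate (J.conjugate y)) c := fun y => by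
    simp only [Φ, mul_assoc, mapH_mul, mul_one, one_mul]
  have hspan : Submodule.span ℂ {y | ∃ s ∈ algS W, ∃ t ∈ algShat W, y = s * star t} ≤
      C.comap (hΦ.isLinearMap.mk' Φ) := by
    refine Submodule.span_le.2 ?_
    rintro _ ⟨s, hs, t, ht, rfl⟩
    have hs_mul : IsNormalMap fun y => Φ (s * y) := hΦ.comp (IsNormalMap.id.const_mul s)
    exact algShat_subset (C := C.comap (hs_mul.isLinearMap.mk' _))
      (isClosed_of_isClosed_sigmaWeak (hs_mul.isClosed_comap hC))
      (fun p q => by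
        change Φ _ ∈ C
        rw [hΦ_eq]
        exact hW.mul_mapH_conjugate_mem hC h ((isLeast_generatedVN _).1 hs) p q c)
      (star_mem_algShat_star ht)
  have hmem : Φ (J.conjugate (Jhat.conjugate x)) ∈ C :=
    hΦ.mem_of_mem_sigmaWeakClosure hC hspan (hW.isTrim.symm ▸ Set.mem_univ _)
  simpa only [hΦ_eq, AntiunitaryInvolution.conjugate_conjugate] using hmem

theorem mem_of_mapH_mul_mul_mapH_mem
    (hC : IsClosed[sigmaWeakTopology (HTensor H H)] (C : Set (HTensor H H →L[ℂ] HTensor H H)))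
    (h : ∀ x b, mapH x 1 * W * mapH 1 b ∈ C) (X : HTensor H H →L[ℂ] HTensor H H) : X ∈ C := by
  have hmem := (IsNormalMap.id.const_mul W).mem_of_mapH hC (hW.mul_mapH_mem hC h) (star W * X)
  rwa [← mul_assoc, hW.isMultiplicativeUnitary.mul_star_self, one_mul] at hmem

theorem vectorSlice_mul_vectorSlice_star_mem {D : Submodule ℂ (H →L[ℂ] H)}
    (hD : IsClosed[sigmaWeakTopology H] (D : Set (H →L[ℂ] H)))
    (h : ∀ p q, vectorSlice rightLeg p q (star W) ∈ D) (p q p' q' : H) :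
    vectorSlice rightLeg p q W * vectorSlice rightLeg p' q' (star W) ∈ D := by
  let Φ : (HTensor H H →L[ℂ] HTensor H H) → H →L[ℂ] H := fun X =>
    vectorSlice rightLeg (tmulH p' p) (tmulH q' q) (leg13 W * leg23 X * leg12 (star W))
  have hΦ : IsNormalMap Φ :=
    ((IsNormalMap.id.leg23.const_mul _).mul_const _).vectorSlice _ _ _
  have hΦW : ∀ x b, Φ (mapH x 1 * W * mapH 1 b) ∈ D := fun x b => by
    have hleg : leg13 W * leg23 (mapH x 1 * W * mapH 1 b) * leg12 (star W) =
        leg23 (mapH x 1) * (leg12 (star W) * leg23 (W * mapH 1 b)) :=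
      calc leg13 W * leg23 (mapH x 1 * W * mapH 1 b) * leg12 (star W)
          = leg13 W * leg23 (mapH x 1) * leg23 W * (leg23 (mapH 1 b) * leg12 (star W)) := by
            simp only [leg23_mul, mul_assoc]
        _ = leg23 (mapH x 1) * (leg13 W * leg23 W * leg12 (star W)) * leg23 (mapH 1 b) := by
            rw [(commute_leg13_leg23_mapH_one W x).eq,
              ← (commute_leg12_leg23_one_mapH (star W) b).eq]
            simp only [mul_assoc]
        _ = leg23 (mapH x 1) * (leg12 (star W) * leg23 (W * mapH 1 b)) := by
            rw [hW.isMultiplicativeUnitary.leg13_mul_leg23_mul_leg12_star, leg23_mul W]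
            simp only [mul_assoc]
    simp only [Φ, hleg, vectorSlice_leg23_mul, vectorSlice_mul_leg23]
    exact (vectorSlice_leg12_mem_iff (isClosed_of_isClosed_sigmaWeak hD)).2 h _ _
  have hone := hW.mem_of_mapH_mul_mul_mapH_mem (hΦ.isClosed_comap hD) hΦW 1
  have hΦone : Φ 1 = vectorSlice rightLeg p q W * vectorSlice rightLeg p' q' (star W) := by
    simpa [Φ] using vectorSlice_leg13_mul_mapH_mul_leg12 p' p q' q 1 1 W (star W)
  exact hΦone ▸ hone

end IsQuantumGroupFrame

section VonNeumann

variable {H : Type*} [NormedAddCommGroup H] [InnerProductSpace ℂ H] [CompleteSpace H]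
  {s : Set (H →L[ℂ] H)}

theorem coe_generatedVN (s : Set (H →L[ℂ] H)) :
    (generatedVN s : Set (H →L[ℂ] H)) = (s ∪ star s).centralizer.centralizer :=
  StarSubalgebra.coe_centralizer_centralizer ℂ s

theorem generatedVN_star (s : Set (H →L[ℂ] H)) : generatedVN (star s) = generatedVN s :=
  SetLike.coe_injective <| by rw [coe_generatedVN, coe_generatedVN, star_star, Set.union_comm]

theorem sigmaWeakClosure_eq_generatedVN (A : NonUnitalStarSubalgebra ℂ (H →L[ℂ] H))
    (hA : ∀ h, (∀ a ∈ A, a h = 0) → h = 0) (hs : (A : Set (H →L[ℂ] H)) = sigmaWeakClosure s) :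
    sigmaWeakClosure s = (generatedVN s : Set (H →L[ℂ] H)) := by
  have hclosed : IsClosed[sigmaWeakTopology H] (generatedVN s : Set (H →L[ℂ] H)) :=
    (coe_generatedVN s).symm ▸ isClosed_sigmaWeak_centralizer _
  refine (sigmaWeakClosure_subset (isLeast_generatedVN s).1 hclosed).antisymm ?_
  have hsA : s ⊆ A := hs ▸ subset_sigmaWeakClosure s
  have hstar : star s ⊆ A := fun x hx => star_star x ▸ star_mem (hsA hx)
  calc (generatedVN s : Set (H →L[ℂ] H)) = (s ∪ star s).centralizer.centralizer :=
        coe_generatedVN s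
    _ ⊆ (A : Set (H →L[ℂ] H)).centralizer.centralizer :=
        Set.centralizer_subset (Set.centralizer_subset (Set.union_subset hsA hstar))
    _ = sigmaWeakClosure A := (sigmaWeakClosure_eq_centralizer_centralizer A hA).symm
    _ ⊆ sigmaWeakClosure s := sigmaWeakClosure_subset hs.subset (isClosed_sigmaWeakClosure s)

end VonNeumann

section ClosureAlgS

variable {H : Type*} [NormedAddCommGroup H] [InnerProductSpace ℂ H] [CompleteSpace H]
  {W : HTensor H H →L[ℂ] HTensor H H} {J Jhat : AntiunitaryInvolution H}

theorem vectorSlice_mem_sigmaWeakClosure_algS (W : HTensor H H →L[ℂ] HTensor H H) (p q : H) :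
    vectorSlice rightLeg p q W ∈ sigmaWeakClosureSubmodule (sliceSubmodule leftLeg W) :=
  subset_sigmaWeakClosure (algS W) (vectorSlice_mem_algS W p q)

theorem IsNormalMap.mem_of_mem_sigmaWeakClosure_algS {K : Type*} [NormedAddCommGroup K]
    [InnerProductSpace ℂ K] {Φ : (H →L[ℂ] H) → K →L[ℂ] K} (hΦ : IsNormalMap Φ)
    {C : Submodule ℂ (K →L[ℂ] K)} (hC : IsClosed[sigmaWeakTopology K] (C : Set (K →L[ℂ] K)))
    (h : ∀ p q, Φ (QGF.vectorSlice rightLeg p q W) ∈ C) {x : H →L[ℂ] H}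
    (hx : x ∈ sigmaWeakClosure (algS W)) : Φ x ∈ C :=
  hΦ.mem_of_mem_sigmaWeakClosure hC
    (algS_subset (isClosed_of_isClosed_sigmaWeak (hΦ.isClosed_comap hC)) h) hx

theorem IsMultiplicativeUnitary.mul_mem_sigmaWeakClosure_algS (hW : IsMultiplicativeUnitary W)
    {x y : H →L[ℂ] H} (hx : x ∈ sigmaWeakClosure (algS W))
    (hy : y ∈ sigmaWeakClosure (algS W)) : x * y ∈ sigmaWeakClosure (algS W) := by
  have hC := isClosed_sigmaWeakClosure (algS W)
  let C := sigmaWeakClosureSubmodule (sliceSubmodule leftLeg W)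
  refine (IsNormalMap.id.mul_const y).mem_of_mem_sigmaWeakClosure_algS (C := C) hC
    (fun p q => ?_) hx
  refine (IsNormalMap.id.const_mul _).mem_of_mem_sigmaWeakClosure_algS (C := C) hC
    (fun p' q' => ?_) hy
  exact hW.vectorSlice_mul_vectorSlice_mem (isClosed_of_isClosed_sigmaWeak hC)
    (vectorSlice_mem_sigmaWeakClosure_algS W) p q p' q'

theorem IsMultiplicativeUnitary.eq_zero_of_algS_apply_eq_zero (hW : IsMultiplicativeUnitary W)
    {h : H} (hh : ∀ s ∈ algS W, s h = 0) : h = 0 := by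
  have hWh : W (tmulH h h) = 0 := eq_of_inner_tmulH fun x y => by
    have hs := congrArg (⟪x, ·⟫_ℂ) (hh _ (vectorSlice_mem_algS W y h))
    simpa [vectorSlice, ContinuousLinearMap.adjoint_inner_right] using hs
  have htmul : tmulH h h = 0 := by
    simpa [hWh] using (DFunLike.congr_fun hW.star_mul_self (tmulH h h)).symm
  simpa [norm_tmulH] using congrArg norm htmul

namespace IsQuantumGroupFrame

variable (hW : IsQuantumGroupFrame W J Jhat)
include hW

theorem star_mem_sigmaWeakClosure_algS {x : H →L[ℂ] H} (hx : x ∈ sigmaWeakClosure (algS W)) :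
    star x ∈ sigmaWeakClosure (algS W) := by
  let C := sigmaWeakClosureSubmodule (sliceSubmodule leftLeg W)
  let D : Submodule ℂ (H →L[ℂ] H) :=
    C.comap (starLinearEquiv ℂ : (H →L[ℂ] H) ≃ₗ⋆[ℂ] H →L[ℂ] H).toLinearMap
  have mem_D {y : H →L[ℂ] H} : y ∈ D ↔ star y ∈ C := Iff.rfl
  have hC : IsClosed[sigmaWeakTopology H] (C : Set (H →L[ℂ] H)) :=
    isClosed_sigmaWeakClosure (algS W)
  have hD : IsClosed[sigmaWeakTopology H] (D : Set (H →L[ℂ] H)) :=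
    @IsClosed.preimage _ _ (sigmaWeakTopology H) (sigmaWeakTopology H) _
      continuous_star_sigmaWeak _ hC
  have star_mem_D : ∀ p q, vectorSlice rightLeg p q (star W) ∈ D := fun p q => by
    rw [mem_D, star_vectorSlice, star_star]
    exact vectorSlice_mem_sigmaWeakClosure_algS W q p
  have mul_star_mem_C : ∀ p q p' q',
      vectorSlice rightLeg p q W * vectorSlice rightLeg p' q' (star W) ∈ C := fun p q p' q' => by
    have h := hW.vectorSlice_mul_vectorSlice_star_mem hD star_mem_D q' p' q p
    rwa [mem_D, star_mul, star_vectorSlice, star_vectorSlice, star_star] at h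
  suffices x ∈ D from this
  refine IsNormalMap.id.mem_of_mem_sigmaWeakClosure_algS hD (fun p q => ?_) hx
  rw [mem_D, star_vectorSlice]
  exact hW.isMultiplicativeUnitary.vectorSlice_star_mem hC mul_star_mem_C q p

/-- The `σ`-weak closure of `S`, as a `*`-algebra. -/
def sigmaWeakClosureAlgS : NonUnitalStarSubalgebra ℂ (H →L[ℂ] H) where
  __ := sigmaWeakClosureSubmodule (sliceSubmodule leftLeg W)
  mul_mem' := hW.isMultiplicativeUnitary.mul_mem_sigmaWeakClosure_algS
  star_mem' := hW.star_mem_sigmaWeakClosure_algS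

theorem sigmaWeakClosure_algS_eq :
    sigmaWeakClosure (algS W) = (algM W : Set (H →L[ℂ] H)) :=
  sigmaWeakClosure_eq_generatedVN hW.sigmaWeakClosureAlgS
    (fun _ h => hW.isMultiplicativeUnitary.eq_zero_of_algS_apply_eq_zero fun s hs =>
      h s (subset_sigmaWeakClosure _ hs)) rfl

end IsQuantumGroupFrame

end ClosureAlgS

section Reverse

variable {H : Type*} [NormedAddCommGroup H] [InnerProductSpace ℂ H]

variable (H) in
/-- The reversal `x ⊗ y ⊗ z ↦ z ⊗ y ⊗ x`. -/
def reverseH : HTensor H (HTensor H H) →L[ℂ] HTensor H (HTensor H H) :=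
  leg12 flipH * leg23 flipH * leg12 flipH

@[simp] theorem leg12_flipH_tmulH (x y z : H) :
    leg12 flipH (tmulH x (tmulH y z)) = tmulH y (tmulH x z) := by
  simp [leg12]

@[simp] theorem reverseH_tmulH (x y z : H) :
    reverseH H (tmulH x (tmulH y z)) = tmulH z (tmulH y x) := by
  simp [reverseH]

theorem reverseH_mul_reverseH : reverseH H * reverseH H = 1 :=
  ext_tmulH₃ fun x y z => by simp

theorem reverseH_conj_mul (S T : HTensor H (HTensor H H) →L[ℂ] HTensor H (HTensor H H)) :
    reverseH H * (S * T) * reverseH H =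
      (reverseH H * S * reverseH H) * (reverseH H * T * reverseH H) :=
  calc reverseH H * (S * T) * reverseH H
      = reverseH H * S * 1 * (T * reverseH H) := by simp only [mul_assoc, one_mul]
    _ = (reverseH H * S * reverseH H) * (reverseH H * T * reverseH H) := by
        simp only [← reverseH_mul_reverseH, mul_assoc]

theorem flipH_mul_mapH_mul_flipH (a b : H →L[ℂ] H) : flipH * mapH a b * flipH = mapH b a :=
  ext_tmulH fun x y => by simp

variable [CompleteSpace H] (T : HTensor H H →L[ℂ] HTensor H H)

theorem reverseH_conj_leg12 :
    reverseH H * leg12 T * reverseH H = leg23 (flipH * T * flipH) :=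
  ((IsNormalMap.id.leg12.const_mul _).mul_const _).ext_mapH
    (((IsNormalMap.id.const_mul _).mul_const _).leg23)
    (fun a b => ext_tmulH₃ fun x y z => by simp [flipH_mul_mapH_mul_flipH]) T

theorem reverseH_conj_leg13 :
    reverseH H * leg13 T * reverseH H = leg13 (flipH * T * flipH) :=
  ((IsNormalMap.id.leg13.const_mul _).mul_const _).ext_mapH
    (((IsNormalMap.id.const_mul _).mul_const _).leg13)
    (fun a b => ext_tmulH₃ fun x y z => by simp [flipH_mul_mapH_mul_flipH]) T

theorem reverseH_conj_leg23 :
    reverseH H * leg23 T * reverseH H = leg12 (flipH * T * flipH) :=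
  ((IsNormalMap.id.leg23.const_mul _).mul_const _).ext_mapH
    (((IsNormalMap.id.const_mul _).mul_const _).leg12)
    (fun a b => ext_tmulH₃ fun x y z => by simp [flipH_mul_mapH_mul_flipH]) T

end Reverse

section Dual

variable {H : Type*} [NormedAddCommGroup H] [InnerProductSpace ℂ H]

theorem AntiunitaryInvolution.prod_flipH (J K : AntiunitaryInvolution H) (t : HTensor H H) :
    (J.prod K).toFun (flipH t) = flipH ((K.prod J).toFun t) := by
  have h : (J.prod K).toCLM.comp flipH =
      (flipH : HTensor H H →L[ℂ] HTensor H H).comp (K.prod J).toCLM :=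
    ext_tmulH fun x y => by simp
  exact DFunLike.congr_fun h t

theorem AntiunitaryInvolution.conjugate_prod_flipH (J K : AntiunitaryInvolution H)
    (T : HTensor H H →L[ℂ] HTensor H H) :
    (J.prod K).conjugate (flipH * T * flipH) = flipH * (K.prod J).conjugate T * flipH := by
  ext t
  simp [prod_flipH]

/-- The dual `Ŵ = Σ W* Σ` of a multiplicative unitary `W`. Passing to it exchanges `S` with `Ŝ*` and
`J` with `Ĵ`. -/
def dual (W : HTensor H H →L[ℂ] HTensor H H) : HTensor H H →L[ℂ] HTensor H H :=
  flipH * star W * flipH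

theorem star_dual (W : HTensor H H →L[ℂ] HTensor H H) : star (dual W) = flipH * W * flipH := by
  simp only [dual, star_mul, star_flipH, star_star, mul_assoc]

variable [CompleteSpace H]

theorem IsMultiplicativeUnitary.dual {W : HTensor H H →L[ℂ] HTensor H H}
    (hW : IsMultiplicativeUnitary W) :
    IsMultiplicativeUnitary (QGF.dual W) where
  mem_unitary := by
    have flipH_mem : (flipH : HTensor H H →L[ℂ] HTensor H H) ∈ unitary _ := by
      rw [Unitary.mem_iff, star_flipH, flipH_mul_flipH]
      exact ⟨rfl, rfl⟩
    exact mul_mem (mul_mem flipH_mem (Unitary.star_mem hW.mem_unitary)) flipH_mem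
  pentagon := by
    have h := congrArg (fun T => reverseH H * star T * reverseH H) hW.pentagon
    simp only [star_mul, star_leg12, star_leg13, star_leg23, reverseH_conj_mul,
      reverseH_conj_leg12, reverseH_conj_leg13, reverseH_conj_leg23] at h
    rwa [mul_assoc]

theorem sliceAlong_leftLeg_flipH (T : HTensor H H →L[ℂ] HTensor H H)
    (ω : StrongDual ℂ (H →L[ℂ] H)) :
    sliceAlong leftLeg (flipH * T * flipH) ω = sliceAlong rightLeg T ω := by
  ext x
  refine ext_inner_left ℂ fun y => ?_
  rw [inner_sliceAlong, inner_sliceAlong, ← flipH_comp_leftLeg x, ← flipH_comp_leftLeg y,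
    ContinuousLinearMap.adjoint_comp, adjoint_flipH]
  rfl

theorem sliceAlong_rightLeg_flipH (T : HTensor H H →L[ℂ] HTensor H H)
    (ω : StrongDual ℂ (H →L[ℂ] H)) :
    sliceAlong rightLeg (flipH * T * flipH) ω = sliceAlong leftLeg T ω := by
  ext x
  refine ext_inner_left ℂ fun y => ?_
  rw [inner_sliceAlong, inner_sliceAlong, ← flipH_comp_rightLeg x, ← flipH_comp_rightLeg y,
    ContinuousLinearMap.adjoint_comp, adjoint_flipH]
  rfl

theorem algS_star (W : HTensor H H →L[ℂ] HTensor H H) : algS (star W) = star (algS W) := by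
  ext x
  exact ⟨fun hx => star_star W ▸ star_mem_algS_star hx,
    fun hx => star_star x ▸ star_mem_algS_star hx⟩

theorem algShat_star (W : HTensor H H →L[ℂ] HTensor H H) :
    algShat (star W) = star (algShat W) := by
  ext x
  exact ⟨fun hx => star_star W ▸ star_mem_algShat_star hx,
    fun hx => star_star x ▸ star_mem_algShat_star hx⟩

theorem algS_dual (W : HTensor H H →L[ℂ] HTensor H H) : algS (dual W) = star (algShat W) := by
  rw [← algShat_star]
  simp only [algS, algShat, sliceRight, sliceLeft, dual, sliceAlong_leftLeg_flipH]

theorem algShat_dual (W : HTensor H H →L[ℂ] HTensor H H) : algShat (dual W) = star (algS W) := by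
  rw [← algS_star]
  simp only [algS, algShat, sliceRight, sliceLeft, dual, sliceAlong_rightLeg_flipH]

theorem algM_dual (W : HTensor H H →L[ℂ] HTensor H H) : algM (dual W) = algMhat W := by
  rw [algM, algS_dual, generatedVN_star, algMhat]

theorem algMhat_dual (W : HTensor H H →L[ℂ] HTensor H H) : algMhat (dual W) = algM W := by
  rw [algMhat, algShat_dual, generatedVN_star, algM]

end Dual

section TrimDual

variable {H : Type*} [NormedAddCommGroup H] [InnerProductSpace ℂ H] [CompleteSpace H]
  {W : HTensor H H →L[ℂ] HTensor H H} {C : Submodule ℂ (H →L[ℂ] H)}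

theorem vectorSlice_midLeg_leg23_mul_leg12 (p p' q q' : H)
    (T T' : HTensor H H →L[ℂ] HTensor H H) :
    vectorSlice midLeg (tmulH p p') (tmulH q q') (leg23 T' * leg12 T) =
      vectorSlice rightLeg p' q' T' * vectorSlice leftLeg p q T := by
  refine (((IsNormalMap.id.leg12).const_mul _).vectorSlice _ _ _).ext_mapH
    ((IsNormalMap.id.vectorSlice _ _ _).const_mul _) (fun a b => ?_) T
  refine (((IsNormalMap.id.leg23).mul_const _).vectorSlice _ _ _).ext_mapH
    ((IsNormalMap.id.vectorSlice _ _ _).mul_const _) (fun c d => ?_) T'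
  simp [mapH_mul, smul_smul]

theorem vectorSlice_midLeg_leg13_star_mul (P Q : HTensor H H)
    (A : HTensor H H →L[ℂ] HTensor H H) (T : _ →L[ℂ] HTensor H (HTensor H H)) :
    vectorSlice midLeg P Q (leg13 (star A) * T) = vectorSlice midLeg (A P) Q T := by
  have h := mul_vectorSlice (q := Q) (A := leg13 (star A)) (a := 1)
    (by rw [star_leg13, star_star, leg13_comp_midLeg A P, star_one]; rfl) T
  rwa [one_mul] at h

namespace IsMultiplicativeUnitary

variable (hW : IsMultiplicativeUnitary W)
include hW

theorem vectorSlice_mul_star_vectorSlice_mem (hC : IsClosed (C : Set (H →L[ℂ] H)))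
    (h : ∀ p q p' q',
      vectorSlice leftLeg p q (star W) * vectorSlice rightLeg p' q' W ∈ C) (p q p' q' : H) :
    vectorSlice rightLeg p' q' W * vectorSlice leftLeg p q (star W) ∈ C := by
  rw [← vectorSlice_midLeg_leg23_mul_leg12, hW.leg23_mul_leg12_star,
    vectorSlice_midLeg_leg13_star_mul]
  exact vectorSlice_mem_of_tmulH hC
    (fun p p' q q' => vectorSlice_midLeg_leg12_mul_leg23 p p' q q' (star W) W ▸ h _ _ _ _) _ _

theorem mul_star_mem (hC : IsClosed (C : Set (H →L[ℂ] H)))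
    (h : ∀ t ∈ algShat W, ∀ s ∈ algS W, star t * s ∈ C) {s t : H →L[ℂ] H} (hs : s ∈ algS W)
    (ht : t ∈ algShat W) : s * star t ∈ C := by
  have mul_mem (p q : H) (s) (hs : s ∈ algS W) : s * vectorSlice leftLeg p q (star W) ∈ C := by
    suffices algS W ⊆ C.comap (LinearMap.mulRight ℂ (vectorSlice leftLeg p q (star W))) by
      simpa only [LinearMap.mulRight_apply] using Submodule.mem_comap.1 (this hs)
    refine algS_subset (hC.preimage (continuous_mul_const _)) fun p' q' => ?_
    rw [Submodule.mem_comap, LinearMap.mulRight_apply]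
    refine hW.vectorSlice_mul_star_vectorSlice_mem hC (fun p q p' q' => ?_) p q p' q'
    rw [← star_star (vectorSlice leftLeg p q _), star_vectorSlice, star_star]
    exact h _ (vectorSlice_mem_algShat W q p) _ (vectorSlice_mem_algS W p' q')
  suffices algShat (star W) ⊆ C.comap (LinearMap.mulLeft ℂ s) by
    simpa only [LinearMap.mulLeft_apply] using
      Submodule.mem_comap.1 (this (star_mem_algShat_star ht))
  refine algShat_subset (hC.preimage (continuous_const_mul _)) fun p q => ?_
  rw [Submodule.mem_comap, LinearMap.mulLeft_apply]
  exact mul_mem p q s hs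

theorem isTrim_dual (h : IsTrim W) : IsTrim (QGF.dual W) := by
  let C := Submodule.span ℂ
    {x : H →L[ℂ] H | ∃ s ∈ algS (QGF.dual W), ∃ t ∈ algShat (QGF.dual W), x = s * star t}
  have hC := isClosed_sigmaWeakClosure (C : Set (H →L[ℂ] H))
  have star_mul_mem : ∀ t ∈ algShat W, ∀ s ∈ algS W,
      star t * s ∈ sigmaWeakClosureSubmodule C := fun t ht s hs =>
    subset_sigmaWeakClosure (C : Set (H →L[ℂ] H)) <| Submodule.subset_span
      ⟨star t, by rwa [algS_dual, Set.star_mem_star], star s,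
        by rwa [algShat_dual, Set.star_mem_star], by rw [star_star]⟩
  have span_le : Submodule.span ℂ {x | ∃ s ∈ algS W, ∃ t ∈ algShat W, x = s * star t} ≤
      sigmaWeakClosureSubmodule C := by
    refine Submodule.span_le.2 ?_
    rintro _ ⟨s, hs, t, ht, rfl⟩
    exact hW.mul_star_mem (isClosed_of_isClosed_sigmaWeak hC) star_mul_mem hs ht
  exact Set.univ_subset_iff.1 (h ▸ sigmaWeakClosure_subset span_le hC)

end IsMultiplicativeUnitary

end TrimDual

section DualFrame

variable {H : Type*} [NormedAddCommGroup H] [InnerProductSpace ℂ H] [CompleteSpace H]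
  {W : HTensor H H →L[ℂ] HTensor H H} {J Jhat : AntiunitaryInvolution H}

theorem IsQuantumGroupFrame.dual (hW : IsQuantumGroupFrame W J Jhat) :
    IsQuantumGroupFrame (QGF.dual W) Jhat J where
  isMultiplicativeUnitary := hW.isMultiplicativeUnitary.dual
  isTrim := hW.isMultiplicativeUnitary.isTrim_dual hW.isTrim
  star_eq := by
    have h : star (QGF.dual W) = (J.prod Jhat).conjugate (QGF.dual W) := by
      rw [star_dual, QGF.dual, AntiunitaryInvolution.conjugate_prod_flipH, hW.star_eq_conjugate,
        AntiunitaryInvolution.conjugate_conjugate]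
    rwa [AntiunitaryInvolution.conjugate, AntiunitaryInvolution.toCLM_prod] at h
  conj_M := algM_dual W ▸ hW.conj_Mhat
  conj_Mhat := algMhat_dual W ▸ hW.conj_M

theorem star_mem_sigmaWeakClosure_star {s : Set (H →L[ℂ] H)} {x : H →L[ℂ] H}
    (hx : x ∈ sigmaWeakClosure s) : star x ∈ sigmaWeakClosure (star s) :=
  @map_mem_closure _ _ (sigmaWeakTopology H) (sigmaWeakTopology H) _ _ _ _
    continuous_star_sigmaWeak hx fun _ => Set.star_mem_star.2

theorem sigmaWeakClosure_star (s : Set (H →L[ℂ] H)) :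
    sigmaWeakClosure (star s) = star (sigmaWeakClosure s) := by
  ext x
  exact ⟨fun hx => star_star s ▸ star_mem_sigmaWeakClosure_star hx,
    fun hx => star_star x ▸ star_mem_sigmaWeakClosure_star hx⟩

theorem IsQuantumGroupFrame.sigmaWeakClosure_algShat_eq (hW : IsQuantumGroupFrame W J Jhat) :
    sigmaWeakClosure (algShat W) = (algMhat W : Set (H →L[ℂ] H)) :=
  calc sigmaWeakClosure (algShat W) = star (sigmaWeakClosure (algS (QGF.dual W))) := by
        rw [algS_dual, sigmaWeakClosure_star, star_star]
    _ = star (algMhat W : Set (H →L[ℂ] H)) := by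
        rw [hW.dual.sigmaWeakClosure_algS_eq, algM_dual]
    _ = algMhat W := Set.ext fun x =>
        (star_mem_iff : star x ∈ algMhat W ↔ x ∈ algMhat W)

end DualFrame

end QGF

end

theorem mainTheorem1 {H : Type*} [NormedAddCommGroup H] [InnerProductSpace ℂ H] [CompleteSpace H]
    (W : QGF.HTensor H H →L[ℂ] QGF.HTensor H H) (J Jhat : QGF.AntiunitaryInvolution H)
    (hW : QGF.IsQuantumGroupFrame W J Jhat) :
    ((∃ A : NonUnitalStarSubalgebra ℂ (H →L[ℂ] H),
        (A : Set (H →L[ℂ] H)) = QGF.sigmaWeakClosure (QGF.algS W)) ∧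
      QGF.sigmaWeakClosure (QGF.algS W) = (QGF.algM W : Set (H →L[ℂ] H))) ∧
    ((∃ A : NonUnitalStarSubalgebra ℂ (H →L[ℂ] H),
        (A : Set (H →L[ℂ] H)) = QGF.sigmaWeakClosure (QGF.algShat W)) ∧
      QGF.sigmaWeakClosure (QGF.algShat W) = (QGF.algMhat W : Set (H →L[ℂ] H))) := by
  have closure_eq := hW.sigmaWeakClosure_algS_eq
  have closure_eq_hat := hW.sigmaWeakClosure_algShat_eq
  exact ⟨⟨⟨(QGF.algM W).toStarSubalgebra.toNonUnitalStarSubalgebra, closure_eq.symm⟩, closure_eq⟩,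
    ⟨(QGF.algMhat W).toStarSubalgebra.toNonUnitalStarSubalgebra, closure_eq_hat.symm⟩,
    closure_eq_hat⟩
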